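/- Logarithms are to base $2$. A circuit of depth $d$ on a finite set of qubits is a sequence of $d$ layers; a layer consists of gates acting on pairwise disjoint sets of qubits, and any two qubits may interact. Gates are arbitrary single-qubit and two-qubit unitaries; a circuit is *over CNOT and single-qubit gates* if all its gates are CNOT gates or single-qubit gates. For an operator $U$ on $n$ qubits, Control-$U$ is the operator $|0\rangle|\varphi\rangle\mapsto|0\rangle|\varphi\rangle$, $|1\rangle|\varphi\rangle\mapsto|1\rangle U|\varphi\rangle$ on $1+n$ qubits. A circuit *implements an operator on $1+n$ qubits with $s-1$ ancillas* if it acts on the $1+n$ qubits and $s-1$ further qubits ($n+s$ qubits in total) and, whenever the ancillas start in $|0^{s-1}\rangle$, performs the operator exactly and returns the ancillas to $|0^{s-1}\rangle$. For an integer $j\ge 0$, a circuit for the Hadamard test of $\{|0^n\rangle,U\}$ with phase gate $S^j$, $S=\mathrm{diag}(1,i)$, is a circuit that implements, with $s-1$ ancillas, the operator: Hadamard gate on the control qubit, then Control-$U$, then $S^j$ and then a Hadamard gate on the control qubit; and for which, when run on the all-zero state, measuring the control qubit in the computational basis gives the outcome $0$ with probability $$\Pr(0)=\tfrac12\bigl(1+\mathrm{Re}(i^{\,j}\langle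 0^n|U|0^n\rangle)\bigr).$$ (So $\Pr(0)=\frac12(1+\mathrm{Re}\langle 0^n|U|0^n\rangle)$ for $j=0$, $\frac12(1-\mathrm{Im}\langle 0^n|U|0^n\rangle)$ for $j=1$, and $\frac12(1+\mathrm{Im}\langle 0^n|U|0^n\rangle)$ for $j=3$, i.e. for $S^3=S^\dagger$.) **Theorem.** There is an absolute constant $K$ such that for all integers $n$, $s$, $d\ge 0$ with $1\le s\le n$ the following hold. 1. $2\lceil\log s\rceil+12d\lceil\log\frac ns\rceil+9d\le K\bigl(\log s+d\log\frac ns+d\bigr)$. 2. Let $\mathcal C$ be an $n$-qubit circuit of depth $d$ over CNOT and single-qubit gates. Then Control-$\mathcal C$ is implemented with $s-1$ ancillas by a circuit over CNOT and single-qubit gates of depth at most $$2\lceil\log s\rceil+12d\lceil\log\tfrac ns\rceil+9d .$$ Moreover, for every $j\ge 0$ there is a circuit over CNOT and single-qubit gates on these $n+s$ qubits, of depth at most $2\lceil\log s\rceil+12d\lceil\log\frac ns\rceil+9d+2$, for the Hadamard test of $\{|0^n\rangle,\mathcal C\}$ with phase gate $S^j$. 3. Let $\mathcal C$ be an $n$-qubit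 circuit of depth $d$ with arbitrary single-qubit and two-qubit gates. Then Control-$\mathcal C$ is implemented with $s-1$ ancillas by a circuit over CNOT and single-qubit gates of depth at most $K\bigl(\log s+d\log\frac ns+d\bigr)$. Moreover, if $d\ge1$, then for every $j\ge 0$ there is a circuit over CNOT and single-qubit gates on these $n+s$ qubits, of depth at most $K\bigl(\log s+d\log\frac ns+d\bigr)$, for the Hadamard test of $\{|0^n\rangle,\mathcal C\}$ with phase gate $S^j$. -/

import Mathlib

noncomputable section

/-- Computational basis states of a register whose qubits are indexed by `Q`. -/
abbrev QBasis (Q : Type) : Type := Q → Fin 2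

/-- (Unnormalized) state vectors of the register `Q`. -/
abbrev QState (Q : Type) : Type := QBasis Q → ℂ

/-- Operators on the register `Q`; rows index outputs and columns index inputs. -/
abbrev QOp (Q : Type) : Type := Matrix (QBasis Q) (QBasis Q) ℂ

/-- The CNOT matrix; the first qubit is the control, the second one the target:
`|a, b⟩ ↦ |a, b ⊕ a⟩`. -/
def cnotMatrix : Matrix (Fin 2 × Fin 2) (Fin 2 × Fin 2) ℂ :=
  fun x y => if x = (y.1, y.2 + y.1) then 1 else 0

/-- Gates on the register `Q`: an arbitrary unitary on one qubit, or an arbitrary unitary on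
two distinct qubits (all-to-all connectivity). -/
inductive QGate (Q : Type) : Type
  | one (q : Q) (U : Matrix.unitaryGroup (Fin 2) ℂ) : QGate Q
  | two (p q : Q) (hpq : p ≠ q) (U : Matrix.unitaryGroup (Fin 2 × Fin 2) ℂ) : QGate Q

namespace QGate

variable {Q : Type} [Fintype Q] [DecidableEq Q]

/-- The qubits on which a gate acts. -/
def support : QGate Q → Finset Q
  | one q _ => {q}
  | two p q _ _ => {p, q}

/-- The operator on the whole register: the gate on its qubits, the identity elsewhere. -/
def toMatrix : QGate Q → QOp Q
  | one q U => fun x y => if ∀ r, r ≠ q → x r = y r then U.1 (x q) (y q) else 0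
  | two p q _ U => fun x y =>
      if ∀ r, r ≠ p → r ≠ q → x r = y r then U.1 (x p, x q) (y p, y q) else 0

/-- The gate is a single-qubit gate or a CNOT gate (with any control and any target). -/
def IsCnotOrSingle : QGate Q → Prop
  | one _ _ => True
  | two _ _ _ U => U.1 = cnotMatrix

end QGate

/-- A one-layer circuit: finitely many gates acting on pairwise disjoint sets of qubits. -/
structure QLayer (Q : Type) [Fintype Q] [DecidableEq Q] : Type where
  gates : List (QGate Q)
  disjoint : gates.Pairwise fun g h => Disjoint g.support h.support

/-- The operator of a layer. The gates commute, so that their order is immaterial. -/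
def QLayer.toMatrix {Q : Type} [Fintype Q] [DecidableEq Q] (L : QLayer Q) : QOp Q :=
  (L.gates.map QGate.toMatrix).prod

/-- A circuit is a sequence of layers, the first layer of the list being applied first. -/
abbrev QCircuit (Q : Type) [Fintype Q] [DecidableEq Q] : Type := List (QLayer Q)

namespace QCircuit

variable {Q : Type} [Fintype Q] [DecidableEq Q]

/-- The depth is the number of layers. -/
def depth (C : QCircuit Q) : ℕ := List.length C

/-- The operator `C⁽ᵈ⁾ ⋯ C⁽¹⁾` of the circuit with layers `C⁽¹⁾, …, C⁽ᵈ⁾`. -/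
def toMatrix : QCircuit Q → QOp Q
  | [] => 1
  | L :: C => toMatrix C * L.toMatrix

/-- All gates of the circuit are CNOT gates or single-qubit gates. -/
def UsesCnotAndSingle (C : QCircuit Q) : Prop :=
  ∀ L : QLayer Q, L ∈ C → ∀ g ∈ L.gates, g.IsCnotOrSingle

end QCircuit

/-- One control qubit (on the left) together with `n` data qubits (on the right). -/
abbrev CtrlReg (n : ℕ) : Type := Unit ⊕ Fin n

/-- The control qubit, `a` ancilla qubits and `n` data qubits. -/
abbrev AncReg (a n : ℕ) : Type := Unit ⊕ (Fin a ⊕ Fin n)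

/-- With `s - 1` ancillas there are `n + s` qubits in total. -/
theorem card_ancReg (s n : ℕ) (hs : 1 ≤ s) : Fintype.card (AncReg (s - 1) n) = n + s := by
  simp only [Fintype.card_sum, Fintype.card_unit, Fintype.card_fin]
  omega

/-- The all-zero basis state `0…0`. -/
def zeroBasis (Q : Type) : QBasis Q := fun _ => 0

/-- The state vector `|0…0⟩`. -/
def zeroKet (Q : Type) [Fintype Q] [DecidableEq Q] : QState Q :=
  Pi.single (zeroBasis Q) 1

/-- The state obtained from a state `ψ` of the control and data qubits by adding `a` ancillas
in the state `|0^a⟩`. -/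
def addZeroAncillas (a : ℕ) {n : ℕ} (ψ : QState (CtrlReg n)) : QState (AncReg a n) :=
  fun x => if ∀ i : Fin a, x (Sum.inr (Sum.inl i)) = 0 then ψ (x ∘ Sum.map id Sum.inr) else 0

/-- The circuit `D` performs the operator `M` on the control and data qubits, with `a`
ancillas that start in `|0^a⟩` and are returned to `|0^a⟩`. -/
def Implements {a n : ℕ} (D : QCircuit (AncReg a n)) (M : QOp (CtrlReg n)) : Prop :=
  ∀ ψ : QState (CtrlReg n),
    D.toMatrix.mulVec (addZeroAncillas a ψ) = addZeroAncillas a (M.mulVec ψ)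

/-- Control-`U`: `|0⟩|φ⟩ ↦ |0⟩|φ⟩` and `|1⟩|φ⟩ ↦ |1⟩ U|φ⟩`. -/
def controlled {n : ℕ} (U : QOp (Fin n)) : QOp (CtrlReg n) := fun x y =>
  if x (Sum.inl ()) = y (Sum.inl ()) then
    (if y (Sum.inl ()) = 0 then (1 : QOp (Fin n)) else U) (x ∘ Sum.inr) (y ∘ Sum.inr)
  else 0

/-- The one-qubit operator `V` on the control qubit, tensored with the identity. -/
def onControl {n : ℕ} (V : Matrix (Fin 2) (Fin 2) ℂ) : QOp (CtrlReg n) := fun x y =>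
  if x ∘ Sum.inr = y ∘ Sum.inr then V (x (Sum.inl ())) (y (Sum.inl ())) else 0

/-- The Hadamard gate. -/
def hadamardGate : Matrix (Fin 2) (Fin 2) ℂ :=
  ((1 / Real.sqrt 2 : ℝ) : ℂ) • !![1, 1; 1, -1]

/-- The phase gate `S`. -/
def phaseGate : Matrix (Fin 2) (Fin 2) ℂ := !![1, 0; 0, Complex.I]

/-- The operator performed before the measurement in the Hadamard test of `{|0ⁿ⟩, U}`:
on the control qubit a Hadamard gate, then Control-`U`, then `Sʲ` and a Hadamard gate on the
control qubit. -/
def hadamardTestOp {n : ℕ} (U : QOp (Fin n)) (j : ℕ) : QOp (CtrlReg n) :=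
  onControl hadamardGate * onControl (phaseGate ^ j) * controlled U * onControl hadamardGate

/-- The probability of the outcome `0` when the circuit `T` is run on the all-zero state of all
the qubits and then the control qubit is measured in the computational basis. -/
def probZero {a n : ℕ} (T : QCircuit (AncReg a n)) : ℝ :=
  ∑ x : QBasis (AncReg a n),
    if x (Sum.inl ()) = 0 then ‖T.toMatrix.mulVec (zeroKet (AncReg a n)) x‖ ^ 2 else 0

/-- `T` is a circuit for the Hadamard test of `{|0ⁿ⟩, U}` with phase gate `Sʲ`: it performs the
operator of the test, and the outcome `0` has probability `(1 + Re (iʲ ⟨0ⁿ|U|0ⁿ⟩)) / 2`. -/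
def IsHadamardTest {a n : ℕ} (T : QCircuit (AncReg a n)) (U : QOp (Fin n)) (j : ℕ) : Prop :=
  Implements T (hadamardTestOp U j) ∧
    probZero T = (1 + (Complex.I ^ j * U (zeroBasis (Fin n)) (zeroBasis (Fin n))).re) / 2

/-- The depth `2⌈log s⌉ + 12 d ⌈log (n/s)⌉ + 9 d`, with logarithms to base two. -/
def controlDepth (n s d : ℕ) : ℕ :=
  2 * ⌈Real.logb 2 (s : ℝ)⌉₊ + 12 * d * ⌈Real.logb 2 ((n : ℝ) / (s : ℝ))⌉₊ + 9 * d

/-- The rate `log s + d log (n/s) + d`, with logarithms to base two. -/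
def depthRate (n s d : ℕ) : ℝ :=
  Real.logb 2 (s : ℝ) + (d : ℝ) * Real.logb 2 ((n : ℝ) / (s : ℝ)) + (d : ℝ)

end

set_option linter.unusedSectionVars false

/-! The control is copied onto the `s - 1` ancillas by a binary tree of CNOTs. A layer then has at
most `n` gates, so each of the `s` copies has to control only a block of `2 ^ L ≥ n / s` of them.
After the last layer the tree is run backwards. It remains to control one layer in depth `8 * L +
9`, which is `exists_controlled_layer`.

Every gate is written as a product of local gates in which the control enters only through factors
`X ^ b`, where `b` is its value. For a one-qubit gate `U` this is the decomposition `A * B * C = 1`,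
`A * X * B * X * C = z⁻¹ • U` (`exists_abc`). For a CNOT it is the Toffoli circuit: with `c, p, q`
the control, source and target bits and `⊕` addition mod 2, `4cpq = c + p + q - (c⊕p) - (c⊕q) -
(p⊕q) + (c⊕p⊕q)`. Phases by an eighth root of unity on these seven parities therefore give the sign
`(-1)^(cpq)`, which Hadamards on the target turn into a doubly controlled X. The phase on `c` alone
is split off, just like the scalar `z` of a one-qubit gate; all these scalars are collected in one
diagonal gate on a copy of the control.

The factors `X ^ b` of a whole layer are fan-outs of the copies. Linear depth is avoided by
conjugation: CNOTs from the copies reach only the roots of trees of height `L`, and conjugating by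
the trees spreads X from the roots to all nodes (`fanOut_mul_patternProj`). This uses only that a
CNOT circuit acts additively over `ℤ/2`, so that it conjugates translations to translations. Four
fan-outs of depth `2 * L + 1` and five local layers make up the layer.

All statements about controls are made after multiplication by the projection `patternProj` onto a
fixed value of the control qubits. On such a subspace the operators factor gate by gate
(`Realizes`), and `implements_controlled` glues the two values of the control together.

Arbitrary two-qubit gates are first rewritten by 35 elementary gates each
(`synthesizable_of_unitary`), by eliminating matrix entries with multiplexers. The Hadamard test
adds one layer before and one after; its outcome probability follows from the implemented operator
and the unit norm of a column of `U`. -/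

noncomputable section

/-! ### Operators on a part of a register. -/

/-- A lawful view of a component of type `B` inside a configuration space `X`. -/
structure QLens (X B : Type) : Type where
  get : X → B
  set : B → X → X
  get_set : ∀ b x, get (set b x) = b
  set_get : ∀ x, set (get x) x = x
  set_set : ∀ b b' x, set b (set b' x) = set b x

namespace QLens

variable {X B C : Type}

/-- The operator `M` on the component seen by the lens, extended by the identity. -/
def op [DecidableEq X] (l : QLens X B) (M : Matrix B B ℂ) : Matrix X X ℂ :=
  fun x y => if l.set (l.get y) x = y then M (l.get x) (l.get y) else 0

/-- The nonzero entries of row `x` can only sit at `y = l.set b x`, one for each `b`, so the sum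
over `X` collapses to a sum over `B`. Products and commutation are read off from this formula. -/
theorem op_mulVec [Fintype X] [DecidableEq X] [Fintype B] (l : QLens X B) (M : Matrix B B ℂ)
    (ψ : X → ℂ) (x : X) :
    (l.op M).mulVec ψ x = ∑ b, M (l.get x) b * ψ (l.set b x) := by
  simp only [Matrix.mulVec, dotProduct, op, ite_mul, zero_mul]
  rw [← Finset.sum_filter]
  refine Finset.sum_bij' (fun y _ => l.get y) (fun b _ => l.set b x) ?_ ?_ ?_ ?_ ?_
  · simp
  · simp [l.get_set]
  · intro y hy; simpa using hy
  · intro b _; exact l.get_set b x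
  · intro y hy
    rw [Finset.mem_filter] at hy
    rw [hy.2]

theorem op_one [Fintype X] [DecidableEq X] [Fintype B] [DecidableEq B] (l : QLens X B) :
    l.op (1 : Matrix B B ℂ) = 1 := by
  apply Matrix.mulVec_injective
  funext ψ x
  simp [op_mulVec, Matrix.one_apply, l.set_get]

theorem op_mul [Fintype X] [DecidableEq X] [Fintype B] (l : QLens X B)
    (M N : Matrix B B ℂ) : l.op (M * N) = l.op M * l.op N := by
  apply Matrix.mulVec_injective
  funext ψ x
  rw [← Matrix.mulVec_mulVec]
  simp only [op_mulVec, l.get_set, l.set_set, Matrix.mul_apply, Finset.sum_mul, Finset.mul_sum]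
  rw [Finset.sum_comm]
  simp only [mul_assoc]

theorem op_smul [DecidableEq X] (l : QLens X B) (c : ℂ) (M : Matrix B B ℂ) :
    l.op (c • M) = c • l.op M := by
  ext x y
  simp [op]

theorem op_conjTranspose [DecidableEq X] (l : QLens X B) (M : Matrix B B ℂ) :
    (l.op M).conjTranspose = l.op M.conjTranspose := by
  have key : ∀ x y, l.set (l.get y) x = y → l.set (l.get x) y = x := by
    intro x y h
    rw [← h, l.set_set, l.set_get]
  ext x y
  simp only [Matrix.conjTranspose_apply, op]
  by_cases h : l.set (l.get x) y = x
  · rw [if_pos h, if_pos (key _ _ h)]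
  · rw [if_neg h, if_neg fun h' => h (key _ _ h'), star_zero]

theorem commute_op [Fintype X] [DecidableEq X] [Fintype B] [Fintype C]
    (l : QLens X B) (m : QLens X C)
    (h : ∀ b c x, l.set b (m.set c x) = m.set c (l.set b x))
    (M : Matrix B B ℂ) (N : Matrix C C ℂ) : Commute (l.op M) (m.op N) := by
  -- Commuting writes already force each write to leave the other view unchanged.
  have h₁ : ∀ c x, l.get (m.set c x) = l.get x := by
    intro c x
    have := h (l.get x) c x
    rw [l.set_get] at this
    rw [← this, l.get_set]
  have h₂ : ∀ b x, m.get (l.set b x) = m.get x := by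
    intro b x
    have := h b (m.get x) x
    rw [m.set_get] at this
    rw [this, m.get_set]
  apply Matrix.mulVec_injective
  funext ψ x
  rw [← Matrix.mulVec_mulVec, ← Matrix.mulVec_mulVec]
  simp only [op_mulVec, h₁, h₂, Finset.mul_sum]
  rw [Finset.sum_comm]
  refine Finset.sum_congr rfl fun c _ => Finset.sum_congr rfl fun b _ => ?_
  rw [h b c x]
  ring

/-- Lenses compose. -/
def comp (l : QLens X B) (m : QLens B C) : QLens X C where
  get x := m.get (l.get x)
  set c x := l.set (m.set c (l.get x)) x
  get_set c x := by rw [l.get_set, m.get_set]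
  set_get x := by rw [m.set_get, l.set_get]
  set_set c c' x := by rw [l.get_set, m.set_set, l.set_set]

/-- This transports identities between 4 × 4 matrices to identities between gates on two qubits of a
large register. -/
theorem op_comp [DecidableEq X] [DecidableEq B] (l : QLens X B) (m : QLens B C)
    (M : Matrix C C ℂ) : (l.comp m).op M = l.op (m.op M) := by
  ext x y
  change (if l.set (m.set (m.get (l.get y)) (l.get x)) x = y then
    M (m.get (l.get x)) (m.get (l.get y)) else 0) = if l.set (l.get y) x = y then
      if m.set (m.get (l.get y)) (l.get x) = l.get y then
        M (m.get (l.get x)) (m.get (l.get y)) else 0 else 0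
  by_cases h : l.set (m.set (m.get (l.get y)) (l.get x)) x = y
  · have h' : m.set (m.get (l.get y)) (l.get x) = l.get y := by
      conv_rhs => rw [← h, l.get_set]
    rw [if_pos h, if_pos (by rw [← h', h]), if_pos h']
  · rw [if_neg h]
    by_cases h₁ : l.set (l.get y) x = y
    · rw [if_pos h₁, if_neg]
      intro h₂
      exact h (by rw [h₂, h₁])
    · rw [if_neg h₁]

@[ext] theorem ext' {l m : QLens X B} (h₁ : ∀ x, l.get x = m.get x)
    (h₂ : ∀ b x, l.set b x = m.set b x) : l = m := by
  cases l; cases m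
  simp only [mk.injEq]
  exact ⟨funext h₁, funext fun b => funext (h₂ b)⟩

/-- The view of one qubit. -/
def qubit {Q : Type} [DecidableEq Q] (q : Q) : QLens (QBasis Q) (Fin 2) where
  get x := x q
  set b x := Function.update x q b
  get_set b x := by simp
  set_get x := by simp
  set_set b b' x := by simp

/-- The view of a pair of distinct qubits. -/
def pair {Q : Type} [DecidableEq Q] (p q : Q) (h : p ≠ q) : QLens (QBasis Q) (Fin 2 × Fin 2) where
  get x := (x p, x q)
  set b x := Function.update (Function.update x p b.1) q b.2
  get_set b x := by simp [Function.update_of_ne h]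
  set_get x := by simp
  set_set b b' x := by
    rw [Function.update_comm h, Function.update_idem, Function.update_comm h.symm,
      Function.update_idem]

/-- The view of a subregister. -/
def subregister {P Q : Type} (δ : P → Q) (h : Function.Injective δ) :
    QLens (QBasis Q) (QBasis P) where
  get x := x ∘ δ
  set u x := Function.extend δ u x
  get_set u x := by
    funext i
    exact h.extend_apply u x i
  set_get x := by
    funext r
    by_cases hr : ∃ i, δ i = r
    · obtain ⟨i, rfl⟩ := hr
      rw [h.extend_apply]; rfl
    · rw [Function.extend_apply' _ _ _ hr]
  set_set u u' x := by
    funext r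
    by_cases hr : ∃ i, δ i = r
    · obtain ⟨i, rfl⟩ := hr
      rw [h.extend_apply, h.extend_apply]
    · rw [Function.extend_apply' _ _ _ hr, Function.extend_apply' _ _ _ hr,
        Function.extend_apply' _ _ _ hr]

/-- The view of the first component of a pair. -/
def first : QLens (B × C) B where
  get x := x.1
  set b x := (b, x.2)
  get_set _ _ := rfl
  set_get _ := rfl
  set_set _ _ _ := rfl

/-- The view of the second component of a pair. -/
def second : QLens (B × C) C where
  get x := x.2
  set c x := (x.1, c)
  get_set _ _ := rfl
  set_get _ := rfl
  set_set _ _ _ := rfl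

/-- The view of a pair with its components exchanged. -/
def exchange : QLens (B × C) (C × B) where
  get x := x.swap
  set b _ := b.swap
  get_set _ _ := rfl
  set_get _ := rfl
  set_set _ _ _ := rfl

variable {Q : Type} [DecidableEq Q]

theorem pair_comp_first (p q : Q) (h : p ≠ q) : (pair p q h).comp first = qubit p := by
  ext1
  · rfl
  · simp [comp, first, pair, qubit, Function.update_comm h]

theorem pair_comp_second (p q : Q) (h : p ≠ q) : (pair p q h).comp second = qubit q := by
  ext1
  · rfl
  · simp [comp, second, pair, qubit]

theorem pair_comp_exchange (p q : Q) (h : p ≠ q) :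
    (pair p q h).comp exchange = pair q p h.symm := by
  ext1
  · rfl
  · simp [comp, exchange, pair, Function.update_comm h]

end QLens

/-! ### Gates, layers and circuits as operators. -/

namespace QGate

variable {Q : Type} [Fintype Q] [DecidableEq Q]

theorem toMatrix_one (q : Q) (U : Matrix.unitaryGroup (Fin 2) ℂ) :
    (one q U).toMatrix = (QLens.qubit q).op U.1 := by
  ext x y
  simp only [toMatrix, QLens.op, QLens.qubit]
  congr 1
  rw [eq_iff_iff, Function.update_eq_iff]
  simp

theorem toMatrix_two (p q : Q) (h : p ≠ q) (U : Matrix.unitaryGroup (Fin 2 × Fin 2) ℂ) :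
    (two p q h U).toMatrix = (QLens.pair p q h).op U.1 := by
  ext x y
  simp only [toMatrix, QLens.op, QLens.pair]
  congr 1
  rw [eq_iff_iff, Function.update_eq_iff]
  simp only [true_and]
  refine forall_congr' fun r => ?_
  by_cases hr : r = p
  · subst hr; simp
  · simp [hr]

theorem commute_toMatrix {g h : QGate Q} (hd : Disjoint g.support h.support) :
    Commute g.toMatrix h.toMatrix := by
  cases g <;> cases h <;>
    simp only [support, Finset.disjoint_singleton_left, Finset.mem_singleton, Finset.mem_insert,
      Finset.disjoint_insert_left, Finset.disjoint_insert_right,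
      Finset.disjoint_singleton_right] at hd <;>
    simp only [toMatrix_one, toMatrix_two] <;>
    refine QLens.commute_op _ _ (fun b c x => ?_) _ _ <;>
    · funext r
      simp only [QLens.qubit, QLens.pair, Function.update_apply]
      grind

theorem toMatrix_mem_unitary (g : QGate Q) : g.toMatrix ∈ Matrix.unitaryGroup (QBasis Q) ℂ := by
  cases g with
  | one q U =>
    rw [toMatrix_one, Matrix.mem_unitaryGroup_iff, Matrix.star_eq_conjTranspose,
      QLens.op_conjTranspose, ← QLens.op_mul, ← Matrix.star_eq_conjTranspose,
      Matrix.mem_unitaryGroup_iff.1 U.2, QLens.op_one]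
  | two p q h U =>
    rw [toMatrix_two, Matrix.mem_unitaryGroup_iff, Matrix.star_eq_conjTranspose,
      QLens.op_conjTranspose, ← QLens.op_mul, ← Matrix.star_eq_conjTranspose,
      Matrix.mem_unitaryGroup_iff.1 U.2, QLens.op_one]

end QGate

/-- The product of a list of gates; the head of the list is applied last. -/
def gatesOp {Q : Type} [Fintype Q] [DecidableEq Q] (l : List (QGate Q)) : QOp Q :=
  (l.map QGate.toMatrix).prod

section gatesOp

variable {Q : Type} [Fintype Q] [DecidableEq Q]

@[simp] theorem gatesOp_nil : gatesOp ([] : List (QGate Q)) = 1 := rfl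

@[simp] theorem gatesOp_cons (g : QGate Q) (l : List (QGate Q)) :
    gatesOp (g :: l) = g.toMatrix * gatesOp l := by
  simp [gatesOp]

theorem gatesOp_append (l l' : List (QGate Q)) : gatesOp (l ++ l') = gatesOp l * gatesOp l' := by
  simp [gatesOp]

theorem QLayer.toMatrix_eq (L : QLayer Q) : L.toMatrix = gatesOp L.gates := rfl

theorem commute_gatesOp {l l' : List (QGate Q)}
    (h : ∀ g ∈ l, ∀ g' ∈ l', Disjoint g.support g'.support) :
    Commute (gatesOp l) (gatesOp l') := by
  unfold gatesOp
  refine Commute.list_prod_left _ _ fun M hM => Commute.list_prod_right _ _ fun N hN => ?_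
  obtain ⟨g, hg, rfl⟩ := List.mem_map.1 hM
  obtain ⟨g', hg', rfl⟩ := List.mem_map.1 hN
  exact QGate.commute_toMatrix (h g hg g' hg')

/-- Gate lists attached to gates with disjoint supports can be merged gate by gate. -/
theorem gatesOp_flatMap_mul {gs : List (QGate Q)}
    (hgs : gs.Pairwise fun g h => Disjoint g.support h.support)
    (e f : QGate Q → List (QGate Q)) (he : ∀ g, ∀ k ∈ e g, k.support ⊆ g.support)
    (hf : ∀ g, ∀ k ∈ f g, k.support ⊆ g.support) :
    gatesOp (gs.flatMap e) * gatesOp (gs.flatMap f) = gatesOp (gs.flatMap fun g => e g ++ f g) := by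
  induction hgs with
  | nil => simp
  | @cons a l ha _ ih =>
    simp only [List.flatMap_cons, gatesOp_append]
    rw [← ih]
    have : Commute (gatesOp (l.flatMap e)) (gatesOp (f a)) := by
      refine commute_gatesOp fun g hg g' hg' => ?_
      obtain ⟨b, hb, hgb⟩ := List.mem_flatMap.1 hg
      exact ((ha b hb).mono (hf a _ hg') (he b _ hgb)).symm
    rw [mul_assoc, mul_assoc, ← mul_assoc (gatesOp (l.flatMap e)), this.eq, mul_assoc]

theorem pairwise_flatMap_disjoint {gs : List (QGate Q)}
    (hgs : gs.Pairwise fun g h => Disjoint g.support h.support)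
    (e : QGate Q → List (QGate Q)) (he : ∀ g, ∀ k ∈ e g, k.support ⊆ g.support)
    (hp : ∀ g, (e g).Pairwise fun g h => Disjoint g.support h.support) :
    (gs.flatMap e).Pairwise fun g h => Disjoint g.support h.support := by
  rw [List.pairwise_flatMap]
  refine ⟨fun a _ => hp a, hgs.imp fun {a b} hab x hx y hy => ?_⟩
  exact hab.mono (he _ _ hx) (he _ _ hy)

namespace QCircuit

theorem toMatrix_append (C D : QCircuit Q) :
    toMatrix (C ++ D) = toMatrix D * toMatrix C := by
  induction C with
  | nil => simp [toMatrix]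
  | cons L C ih => simp [toMatrix, ih, mul_assoc]

theorem toMatrix_mem_unitary (C : QCircuit Q) :
    C.toMatrix ∈ Matrix.unitaryGroup (QBasis Q) ℂ := by
  induction C with
  | nil => exact one_mem _
  | cons L C ih =>
    refine mul_mem ih (Submonoid.list_prod_mem _ fun M hM => ?_)
    obtain ⟨g, _, rfl⟩ := List.mem_map.1 hM
    exact g.toMatrix_mem_unitary

theorem usesCnotAndSingle_append {C D : QCircuit Q} (hC : C.UsesCnotAndSingle)
    (hD : D.UsesCnotAndSingle) : UsesCnotAndSingle (C ++ D) := by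
  intro L hL
  rcases List.mem_append.1 hL with h | h
  · exact hC L h
  · exact hD L h

theorem depth_append (C D : QCircuit Q) : depth (C ++ D) = depth C + depth D :=
  List.length_append

end QCircuit

end gatesOp
end

/-! ### Elementary gates and the Toffoli phase template. -/

noncomputable section

/-- The one-qubit gate `diag(1, z)`. -/
def phaseUnitary (z : Circle) : Matrix.unitaryGroup (Fin 2) ℂ :=
  ⟨!![1, 0; 0, (z : ℂ)], by
    have hz : (z : ℂ) * (starRingEnd ℂ) z = 1 := by
      rw [Complex.mul_conj, Circle.normSq_coe, Complex.ofReal_one]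
    rw [Matrix.mem_unitaryGroup_iff]
    ext i j
    fin_cases i <;> fin_cases j <;> simp [Matrix.mul_apply, Matrix.star_apply, hz]⟩

/-- The Pauli `X` gate. -/
def pauliX : Matrix.unitaryGroup (Fin 2) ℂ :=
  ⟨!![0, 1; 1, 0], by
    rw [Matrix.mem_unitaryGroup_iff]
    ext i j
    fin_cases i <;> fin_cases j <;> simp [Matrix.mul_apply, Matrix.star_apply]⟩

theorem inv_sqrt_two_mul_self :
    ((1 / Real.sqrt 2 : ℝ) : ℂ) * ((1 / Real.sqrt 2 : ℝ) : ℂ) = 1 / 2 := by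
  rw [← Complex.ofReal_mul, div_mul_div_comm, Real.mul_self_sqrt (by norm_num)]
  norm_num

/-- The Hadamard gate as a unitary. -/
def hadamardUnitary : Matrix.unitaryGroup (Fin 2) ℂ :=
  ⟨hadamardGate, by
    rw [Matrix.mem_unitaryGroup_iff]
    have h := inv_sqrt_two_mul_self
    have hc : (starRingEnd ℂ) ((1 / Real.sqrt 2 : ℝ) : ℂ) = ((1 / Real.sqrt 2 : ℝ) : ℂ) :=
      Complex.conj_ofReal _
    unfold hadamardGate
    generalize ((1 / Real.sqrt 2 : ℝ) : ℂ) = r at h hc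
    ext i j
    fin_cases i <;> fin_cases j <;>
      simp [Matrix.mul_apply, Matrix.star_apply, hc, h] <;> norm_num⟩

/-- The CNOT gate as a unitary. -/
def cnotUnitary : Matrix.unitaryGroup (Fin 2 × Fin 2) ℂ :=
  ⟨cnotMatrix, by
    rw [Matrix.mem_unitaryGroup_iff]
    ext ⟨i, j⟩ ⟨k, l⟩
    fin_cases i <;> fin_cases j <;> fin_cases k <;> fin_cases l <;>
      simp [Matrix.mul_apply, Matrix.star_apply, cnotMatrix, Fintype.sum_prod_type]⟩

/-- A primitive eighth root of unity. -/
def eighthRoot : Circle := Circle.exp (Real.pi / 4)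

theorem eighthRoot_pow_four : (eighthRoot : ℂ) ^ 4 = -1 := by
  rw [eighthRoot, Circle.coe_exp, ← Complex.exp_nat_mul, ← Complex.exp_pi_mul_I]
  congr 1
  push_cast
  ring

namespace QLens

variable (ψ : Fin 2 × Fin 2 → ℂ) (x : Fin 2 × Fin 2)

theorem first_phase_mulVec (z : Circle) :
    (first.op (phaseUnitary z).1).mulVec ψ x = (if x.1 = 0 then 1 else (z : ℂ)) * ψ x := by
  obtain ⟨i, j⟩ := x
  fin_cases i <;> simp [op_mulVec, first, phaseUnitary]

theorem second_phase_mulVec (z : Circle) :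
    (second.op (phaseUnitary z).1).mulVec ψ x = (if x.2 = 0 then 1 else (z : ℂ)) * ψ x := by
  obtain ⟨i, j⟩ := x
  fin_cases j <;> simp [op_mulVec, second, phaseUnitary]

theorem first_pauliX_mulVec :
    (first.op pauliX.1).mulVec ψ x = ψ (x.1 + 1, x.2) := by
  obtain ⟨i, j⟩ := x
  fin_cases i <;> simp [op_mulVec, first, pauliX]

theorem second_pauliX_mulVec :
    (second.op pauliX.1).mulVec ψ x = ψ (x.1, x.2 + 1) := by
  obtain ⟨i, j⟩ := x
  fin_cases j <;> simp [op_mulVec, second, pauliX]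

theorem second_hadamard_mulVec :
    (second.op hadamardGate).mulVec ψ x = ((1 / Real.sqrt 2 : ℝ) : ℂ) *
      (ψ (x.1, 0) + (if x.2 = 0 then 1 else -1) * ψ (x.1, 1)) := by
  obtain ⟨i, j⟩ := x
  fin_cases j <;> simp [op_mulVec, second, hadamardGate] <;> ring

theorem cnot_mulVec : cnotMatrix.mulVec ψ x = ψ (x.1, x.2 + x.1) := by
  obtain ⟨i, j⟩ := x
  fin_cases i <;> fin_cases j <;>
    simp [Matrix.mulVec, dotProduct, cnotMatrix, Fintype.sum_prod_type]

theorem exchange_cnot_mulVec :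
    (exchange.op cnotMatrix).mulVec ψ x = ψ (x.1 + x.2, x.2) := by
  obtain ⟨i, j⟩ := x
  fin_cases i <;> fin_cases j <;>
    simp [op_mulVec, cnotMatrix, Fintype.sum_prod_type, exchange]

end QLens

open QLens in
/-- The controlled CNOT template, with the control off. -/
theorem cnot_template_off :
    second.op hadamardUnitary.1 * first.op (phaseUnitary eighthRoot⁻¹).1 * exchange.op cnotMatrix *
      first.op (phaseUnitary eighthRoot).1 * second.op (phaseUnitary eighthRoot⁻¹).1 *
      first.op (phaseUnitary eighthRoot⁻¹).1 * exchange.op cnotMatrix *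
      first.op (phaseUnitary eighthRoot).1 * second.op (phaseUnitary eighthRoot).1 *
      second.op hadamardUnitary.1 = 1 := by
  apply Matrix.mulVec_injective
  funext ψ ⟨i, j⟩
  have h := inv_sqrt_two_mul_self
  have hz : (eighthRoot : ℂ) ≠ 0 := Circle.coe_ne_zero _
  -- With the control off, the phases on `p`, `q` and `p ⊕ q` each meet their inverses. Only the two
  -- Hadamards remain, and they cancel by `h`.
  simp only [← Matrix.mulVec_mulVec, hadamardUnitary, first_phase_mulVec, second_phase_mulVec,
    second_hadamard_mulVec, exchange_cnot_mulVec, Circle.coe_inv, Matrix.one_mulVec]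
  generalize ((1 / Real.sqrt 2 : ℝ) : ℂ) = r at h
  fin_cases i <;> fin_cases j <;> simp [hz]
  · linear_combination (2 * ψ (0, 0)) * h
  · linear_combination (2 * ψ (0, 1)) * h
  · linear_combination (2 * ψ (1, 0)) * h
  · linear_combination (2 * ψ (1, 1)) * h

open QLens in
/-- The controlled CNOT template, with the control on. -/
theorem cnot_template_on :
    second.op hadamardUnitary.1 * first.op pauliX.1 * first.op (phaseUnitary eighthRoot⁻¹).1 *
      exchange.op cnotMatrix * second.op pauliX.1 * first.op (phaseUnitary eighthRoot).1 *
      first.op pauliX.1 * second.op (phaseUnitary eighthRoot⁻¹).1 * second.op pauliX.1 *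
      first.op (phaseUnitary eighthRoot⁻¹).1 * exchange.op cnotMatrix *
      first.op (phaseUnitary eighthRoot).1 * second.op (phaseUnitary eighthRoot).1 *
      second.op hadamardUnitary.1 = (eighthRoot⁻¹ : ℂ) • cnotMatrix := by
  apply Matrix.mulVec_injective
  funext ψ ⟨i, j⟩
  have h := inv_sqrt_two_mul_self
  have h4 := eighthRoot_pow_four
  have hz : (eighthRoot : ℂ) ≠ 0 := Circle.coe_ne_zero _
  simp only [← Matrix.mulVec_mulVec, hadamardUnitary, first_phase_mulVec, second_phase_mulVec,
    second_hadamard_mulVec, exchange_cnot_mulVec, Circle.coe_inv, Matrix.smul_mulVec,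
    first_pauliX_mulVec, second_pauliX_mulVec, cnot_mulVec, Pi.smul_apply]
  generalize ((1 / Real.sqrt 2 : ℝ) : ℂ) = r at h
  generalize (eighthRoot : ℂ) = z at h4 hz
  fin_cases i <;> fin_cases j <;> simp [hz] <;> field_simp
  · linear_combination (2 * ψ (0, 0)) * h
  · linear_combination (2 * ψ (0, 1)) * h
  -- When both the control and the first qubit are set, the two values of the second qubit differ by
  -- the relative phase `z ^ 4 = -1`, which the Hadamards turn into a bit flip.
  · rw [h4]; linear_combination (2 * ψ (1, 1)) * h
  · rw [h4]; linear_combination (2 * ψ (1, 0)) * h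
end

/-! ### ABC decomposition and synthesis of two-qubit unitaries. -/

noncomputable section

/-- If a column of a unitary matrix vanishes off the diagonal, then so does the row. -/
theorem unitary_row_eq_zero {ι : Type} [Fintype ι] [DecidableEq ι] {M : Matrix ι ι ℂ}
    (hM : M ∈ Matrix.unitaryGroup ι ℂ) (j : ι) (h : ∀ i, i ≠ j → M i j = 0) :
    ∀ k, k ≠ j → M j k = 0 := by
  have h₁ : (star M * M) j j = 1 := by rw [Matrix.mem_unitaryGroup_iff'.1 hM, Matrix.one_apply_eq]
  have h₂ : (M * star M) j j = 1 := by rw [Matrix.mem_unitaryGroup_iff.1 hM, Matrix.one_apply_eq]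
  rw [Matrix.mul_apply, Finset.sum_eq_single j
    (fun i _ hi => by rw [h i hi, mul_zero]) (by simp)] at h₁
  -- The column gives the diagonal entry modulus one. The row also has norm one, so nothing is left
  -- for its other entries.
  rw [Matrix.mul_apply, ← Finset.add_sum_erase _ _ (Finset.mem_univ j), mul_comm, h₁,
    add_eq_left] at h₂
  have h₃ : ∑ k ∈ Finset.univ.erase j, Complex.normSq (M j k) = 0 := by
    have h₄ : ((∑ k ∈ Finset.univ.erase j, Complex.normSq (M j k) : ℝ) : ℂ) = 0 := by
      rw [← h₂, Complex.ofReal_sum]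
      refine Finset.sum_congr rfl fun k _ => ?_
      rw [← Complex.mul_conj]; rfl
    exact_mod_cast h₄
  rw [Finset.sum_eq_zero_iff_of_nonneg fun _ _ => Complex.normSq_nonneg _] at h₃
  exact fun k hk => Complex.normSq_eq_zero.1 (h₃ k (by simp [hk]))

/-- The rotation whose first row is the conjugate of `(a, b)` divided by its norm. This is the
elimination step behind both diagonalization and synthesis. -/
theorem exists_unitary_mulVec_eq (a b : ℂ) :
    ∃ (W : Matrix.unitaryGroup (Fin 2) ℂ) (r : ℂ), W.1.mulVec ![a, b] = ![r, 0] := by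
  by_cases h : Complex.normSq a + Complex.normSq b = 0
  · refine ⟨1, 0, ?_⟩
    have ha : a = 0 := Complex.normSq_eq_zero.1
      (by nlinarith [Complex.normSq_nonneg a, Complex.normSq_nonneg b])
    have hb : b = 0 := Complex.normSq_eq_zero.1
      (by nlinarith [Complex.normSq_nonneg a, Complex.normSq_nonneg b])
    simp [ha, hb]
  · set r : ℝ := Real.sqrt (Complex.normSq a + Complex.normSq b) with hr
    have hpos : 0 < Complex.normSq a + Complex.normSq b :=
      lt_of_le_of_ne (add_nonneg (Complex.normSq_nonneg _) (Complex.normSq_nonneg _)) (Ne.symm h)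
    have hr0 : (r : ℂ) ≠ 0 := by
      exact_mod_cast (Real.sqrt_pos.2 hpos).ne'
    have hrr : a * (starRingEnd ℂ) a + b * (starRingEnd ℂ) b = (r : ℂ) * r := by
      rw [Complex.mul_conj, Complex.mul_conj, ← Complex.ofReal_mul, hr,
        Real.mul_self_sqrt hpos.le, Complex.ofReal_add]
    refine ⟨⟨(r : ℂ)⁻¹ • !![(starRingEnd ℂ) a, (starRingEnd ℂ) b; -b, a], ?_⟩, r, ?_⟩
    · rw [Matrix.mem_unitaryGroup_iff]
      ext i j
      fin_cases i <;> fin_cases j <;>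
        simp [Matrix.mul_apply, Matrix.star_apply] <;> field_simp <;>
        first | ring1 | linear_combination hrr
    · funext i
      fin_cases i <;> simp [Matrix.mulVec, dotProduct] <;> field_simp <;>
        first | ring1 | linear_combination hrr

/-- Every one-qubit unitary is unitarily diagonalizable. -/
theorem exists_unitary_conj_eq_diagonal (U : Matrix.unitaryGroup (Fin 2) ℂ) :
    ∃ (V : Matrix.unitaryGroup (Fin 2) ℂ) (z w : Circle),
      U.1 = V.1 * !![(z : ℂ), 0; 0, (w : ℂ)] * (V⁻¹).1 := by
  obtain ⟨l, hl⟩ := Module.End.exists_eigenvalue (Matrix.toLin' U.1)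
  obtain ⟨v, hv⟩ := hl.exists_hasEigenvector
  have hUv : U.1.mulVec v = l • v := by simpa using hv.apply_eq_smul
  obtain ⟨W, r, hW⟩ := exists_unitary_mulVec_eq (v 0) (v 1)
  have hv2 : v = ![v 0, v 1] := by funext i; fin_cases i <;> rfl
  rw [← hv2] at hW
  have hWW : (W⁻¹).1 * W.1 = 1 := Matrix.UnitaryGroup.star_mul_self W
  have hWW' : W.1 * (W⁻¹).1 = 1 := Matrix.mem_unitaryGroup_iff.1 W.2
  have hr : r ≠ 0 := by
    rintro rfl
    apply hv.2
    rw [← Matrix.one_mulVec v, ← hWW, ← Matrix.mulVec_mulVec, hW]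
    funext i
    simp [Matrix.mulVec, dotProduct]
  -- `W` moves the eigenvector to the first axis, so the first column of `M` is diagonal; unitarity
  -- then makes the first row diagonal too.
  set M := W * U * W⁻¹ with hM
  have hcol : M.1.mulVec ![r, 0] = l • ![r, 0] := by
    rw [← hW, hM]
    change (W.1 * U.1 * (W⁻¹).1).mulVec _ = _
    rw [Matrix.mulVec_mulVec, mul_assoc, hWW, mul_one, ← Matrix.mulVec_mulVec, hUv,
      Matrix.mulVec_smul]
  have h10 : M.1 1 0 = 0 := by
    have := congrFun hcol 1
    simpa [Matrix.mulVec, dotProduct, hr] using this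
  have h01 : M.1 0 1 = 0 := by
    refine unitary_row_eq_zero M.2 0 (fun i hi => ?_) 1 (by decide)
    fin_cases i
    · exact absurd rfl hi
    · exact h10
  have hMM := Matrix.mem_unitaryGroup_iff.1 M.2
  have h0 : Complex.normSq (M.1 0 0) = 1 := by
    have := congrFun (congrFun hMM 0) 0
    simp only [Matrix.mul_apply, Fin.sum_univ_two, h01, zero_mul, add_zero, Matrix.one_apply_eq,
      Matrix.star_apply] at this
    have h' : ((Complex.normSq (M.1 0 0) : ℝ) : ℂ) = 1 := by rw [← Complex.mul_conj]; exact this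
    exact_mod_cast h'
  have h1 : Complex.normSq (M.1 1 1) = 1 := by
    have := congrFun (congrFun hMM 1) 1
    simp only [Matrix.mul_apply, Fin.sum_univ_two, h10, zero_mul, zero_add, Matrix.one_apply_eq,
      Matrix.star_apply] at this
    have h' : ((Complex.normSq (M.1 1 1) : ℝ) : ℂ) = 1 := by rw [← Complex.mul_conj]; exact this
    exact_mod_cast h'
  refine ⟨W⁻¹, ⟨M.1 0 0, ?_⟩, ⟨M.1 1 1, ?_⟩, ?_⟩
  · refine mem_sphere_zero_iff_norm.2 ?_
    rw [← sq_eq_sq₀ (norm_nonneg _) zero_le_one, ← Complex.normSq_eq_norm_sq, h0, one_pow]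
  · refine mem_sphere_zero_iff_norm.2 ?_
    rw [← sq_eq_sq₀ (norm_nonneg _) zero_le_one, ← Complex.normSq_eq_norm_sq, h1, one_pow]
  · have : !![M.1 0 0, 0; 0, M.1 1 1] = M.1 := by
      ext i j; fin_cases i <;> fin_cases j <;> simp [h01, h10]
    change U.1 = (W⁻¹).1 * !![M.1 0 0, 0; 0, M.1 1 1] * (W⁻¹⁻¹).1
    rw [this, inv_inv, hM]
    change U.1 = (W⁻¹).1 * (W.1 * U.1 * (W⁻¹).1) * W.1
    rw [mul_assoc, mul_assoc, hWW, mul_one, ← mul_assoc, hWW, one_mul]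

theorem Circle.exists_mul_self_eq (z : Circle) : ∃ w : Circle, w * w = z :=
  ⟨Circle.exp (Complex.arg z / 2), by
    rw [← Circle.exp_add, add_halves, Circle.exp_arg]⟩

/-- The `ABC` decomposition of a one-qubit unitary. -/
theorem exists_abc (U : Matrix.unitaryGroup (Fin 2) ℂ) :
    ∃ (A B C : Matrix.unitaryGroup (Fin 2) ℂ) (z : Circle),
      A.1 * B.1 * C.1 = 1 ∧
        A.1 * pauliX.1 * B.1 * pauliX.1 * C.1 = ((z⁻¹ : Circle) : ℂ) • U.1 := by
  obtain ⟨V, z, w, hU⟩ := exists_unitary_conj_eq_diagonal U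
  -- With `A = V * diag(1, t)`, `B = diag(1, t⁻¹)` and `C = V⁻¹`, inserting the two X gates gives `V
  -- * diag(t⁻¹, t) * V⁻¹`. This is `(t * z)⁻¹ • U` exactly when `t ^ 2 = w / z`.
  obtain ⟨t, ht⟩ := Circle.exists_mul_self_eq (w * z⁻¹)
  have ht' : (t : ℂ) * t = w * (z : ℂ)⁻¹ := by
    rw [← Circle.coe_mul, ht, Circle.coe_mul, Circle.coe_inv]
  have hz : (z : ℂ) ≠ 0 := Circle.coe_ne_zero _
  have htz : (t : ℂ) ≠ 0 := Circle.coe_ne_zero _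
  have hVV : V.1 * (V⁻¹).1 = 1 := Matrix.mem_unitaryGroup_iff.1 V.2
  have hP : (phaseUnitary t).1 * (phaseUnitary t⁻¹).1 = 1 := by
    ext i j
    fin_cases i <;> fin_cases j <;> simp [phaseUnitary, htz]
  refine ⟨V * phaseUnitary t, phaseUnitary t⁻¹, V⁻¹, t * z, ?_, ?_⟩
  · change V.1 * (phaseUnitary t).1 * (phaseUnitary t⁻¹).1 * (V⁻¹).1 = 1
    rw [mul_assoc V.1, hP, mul_one, hVV]
  · change V.1 * (phaseUnitary t).1 * pauliX.1 * (phaseUnitary t⁻¹).1 * pauliX.1 * (V⁻¹).1 = _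
    have : (phaseUnitary t).1 * pauliX.1 * (phaseUnitary t⁻¹).1 * pauliX.1
        = (((t * z)⁻¹ : Circle) : ℂ) • !![(z : ℂ), 0; 0, (w : ℂ)] := by
      ext i j
      fin_cases i <;> fin_cases j <;> simp [phaseUnitary, pauliX, Matrix.mul_apply] <;>
        field_simp
      field_simp at ht'
      linear_combination ht'
    rw [hU, ← Matrix.smul_mul, ← Matrix.mul_smul, ← this]
    simp only [mul_assoc]

/-- The operator that applies `W₀` or `W₁` to the second qubit, selected by the first qubit. -/
def multiplexer (W₀ W₁ : Matrix (Fin 2) (Fin 2) ℂ) :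
    Matrix (Fin 2 × Fin 2) (Fin 2 × Fin 2) ℂ :=
  fun x y => if x.1 = y.1 then (if x.1 = 0 then W₀ else W₁) x.2 y.2 else 0

theorem multiplexer_mul (V₀ V₁ W₀ W₁ : Matrix (Fin 2) (Fin 2) ℂ) :
    multiplexer V₀ V₁ * multiplexer W₀ W₁ = multiplexer (V₀ * W₀) (V₁ * W₁) := by
  ext ⟨i, j⟩ ⟨k, l⟩
  fin_cases i <;> fin_cases k <;>
    simp [Matrix.mul_apply, multiplexer, Fintype.sum_prod_type]

theorem multiplexer_one : multiplexer 1 1 = 1 := by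
  ext ⟨i, j⟩ ⟨k, l⟩
  fin_cases i <;> fin_cases k <;> simp [multiplexer, Matrix.one_apply]

theorem second_op_eq_multiplexer (W : Matrix (Fin 2) (Fin 2) ℂ) :
    QLens.second.op W = multiplexer W W := by
  ext ⟨i, j⟩ ⟨k, l⟩
  fin_cases i <;> fin_cases k <;> simp [multiplexer, QLens.op, QLens.second]

theorem cnotMatrix_eq_multiplexer : cnotMatrix = multiplexer 1 pauliX.1 := by
  ext ⟨i, j⟩ ⟨k, l⟩
  fin_cases i <;> fin_cases j <;> fin_cases k <;> fin_cases l <;>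
    simp [multiplexer, cnotMatrix, pauliX]

theorem first_phase_eq_multiplexer (z : Circle) :
    QLens.first.op (phaseUnitary z).1 = multiplexer 1 ((z : ℂ) • 1) := by
  ext ⟨i, j⟩ ⟨k, l⟩
  fin_cases i <;> fin_cases k <;>
    simp [multiplexer, phaseUnitary, QLens.op, QLens.first, Matrix.one_apply]

theorem multiplexer_mem_unitary (W₀ W₁ : Matrix.unitaryGroup (Fin 2) ℂ) :
    multiplexer W₀.1 W₁.1 ∈ Matrix.unitaryGroup (Fin 2 × Fin 2) ℂ := by
  have : star (multiplexer W₀.1 W₁.1) = multiplexer (star W₀.1) (star W₁.1) := by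
    ext ⟨i, j⟩ ⟨k, l⟩
    fin_cases i <;> fin_cases k <;> simp [multiplexer, Matrix.star_apply]
  rw [Matrix.mem_unitaryGroup_iff, this, multiplexer_mul, Matrix.mem_unitaryGroup_iff.1 W₀.2,
    Matrix.mem_unitaryGroup_iff.1 W₁.2, multiplexer_one]

/-- Two-qubit operators that are products of `k` elementary gates. -/
inductive Synthesizable : ℕ → Matrix (Fin 2 × Fin 2) (Fin 2 × Fin 2) ℂ → Prop
  | first (U : Matrix.unitaryGroup (Fin 2) ℂ) : Synthesizable 1 (QLens.first.op U.1)
  | second (U : Matrix.unitaryGroup (Fin 2) ℂ) : Synthesizable 1 (QLens.second.op U.1)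
  | cnot : Synthesizable 1 cnotMatrix
  | cnot_swap : Synthesizable 1 (QLens.exchange.op cnotMatrix)
  | mul {j k : ℕ} {M N : Matrix (Fin 2 × Fin 2) (Fin 2 × Fin 2) ℂ}
      (hM : Synthesizable j M) (hN : Synthesizable k N) : Synthesizable (j + k) (M * N)

namespace Synthesizable

theorem exchange {k : ℕ} {M : Matrix (Fin 2 × Fin 2) (Fin 2 × Fin 2) ℂ}
    (h : Synthesizable k M) : Synthesizable k (QLens.exchange.op M) := by
  induction h with
  | first U =>
    rw [← QLens.op_comp]
    exact second U
  | second U =>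
    rw [← QLens.op_comp]
    exact first U
  | cnot => exact cnot_swap
  | cnot_swap =>
    rw [← QLens.op_comp]
    have : ((QLens.exchange : QLens (Fin 2 × Fin 2) _).comp QLens.exchange).op cnotMatrix
        = cnotMatrix := by
      ext x y
      simp [QLens.comp, QLens.exchange, QLens.op]
    rw [this]
    exact cnot
  | mul _ _ ih₁ ih₂ => rw [QLens.op_mul]; exact mul ih₁ ih₂

/-- Apply `W₀` unconditionally and then `W₁ * W₀⁻¹` under control. The latter costs three local
gates, two CNOTs and a phase on the selecting qubit, hence seven in all. -/
theorem multiplexer (W₀ W₁ : Matrix.unitaryGroup (Fin 2) ℂ) :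
    Synthesizable 7 (multiplexer W₀.1 W₁.1) := by
  obtain ⟨A, B, C, z, h₀, h₁⟩ := exists_abc (W₁ * W₀⁻¹)
  have h : _root_.multiplexer W₀.1 W₁.1 = QLens.second.op A.1 * cnotMatrix * QLens.second.op B.1 *
      cnotMatrix * QLens.second.op C.1 * QLens.first.op (phaseUnitary z).1 *
      QLens.second.op W₀.1 := by
    simp only [second_op_eq_multiplexer, cnotMatrix_eq_multiplexer, first_phase_eq_multiplexer,
      multiplexer_mul, mul_one, h₀, h₁, one_mul]
    congr 1
    change W₁.1 = _ • (W₁.1 * (W₀⁻¹).1) * z.1 • 1 * W₀.1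
    have hW : (W₀⁻¹).1 * W₀.1 = 1 := Matrix.UnitaryGroup.star_mul_self W₀
    have hz : (z : ℂ) ≠ 0 := Circle.coe_ne_zero _
    rw [Matrix.mul_smul, mul_one, smul_smul, Matrix.smul_mul, mul_assoc, hW, mul_one]
    change W₁.1 = ((z : ℂ) * _) • W₁.1
    rw [Circle.coe_inv, mul_inv_cancel₀ hz, one_smul]
  rw [h]
  exact (((((((second A).mul cnot).mul (second B)).mul cnot).mul (second C)).mul (first _)).mul
    (second W₀))

end Synthesizable

/-- A block diagonal unitary has unitary blocks, since the rows within a block are orthonormal using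
that block's entries alone. -/
theorem exists_eq_multiplexer {M : Matrix (Fin 2 × Fin 2) (Fin 2 × Fin 2) ℂ}
    (hM : M ∈ Matrix.unitaryGroup (Fin 2 × Fin 2) ℂ) (h : ∀ x y, x.1 ≠ y.1 → M x y = 0) :
    ∃ W₀ W₁ : Matrix.unitaryGroup (Fin 2) ℂ, M = multiplexer W₀.1 W₁.1 := by
  have key : ∀ i, Matrix.of (fun j k => M (i, j) (i, k)) ∈
      Matrix.unitaryGroup (Fin 2) ℂ := by
    intro i
    rw [Matrix.mem_unitaryGroup_iff]
    ext j k
    have := congrFun (congrFun (Matrix.mem_unitaryGroup_iff.1 hM) (i, j)) (i, k)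
    rw [Matrix.mul_apply, Fintype.sum_prod_type,
      Finset.sum_eq_single i (fun b _ hb => Finset.sum_eq_zero fun c _ => by
        rw [h _ _ hb.symm, zero_mul]) (by simp)] at this
    rw [Matrix.mul_apply]
    simpa [Matrix.one_apply, Matrix.star_apply] using this
  refine ⟨⟨_, key 0⟩, ⟨_, key 1⟩, ?_⟩
  ext ⟨i, j⟩ ⟨k, l⟩
  by_cases hik : i = k
  · subst hik
    fin_cases i <;> simp [multiplexer]
  · rw [h _ _ hik]
    simp [multiplexer, hik]

theorem multiplexer_mulVec (W₀ W₁ : Matrix (Fin 2) (Fin 2) ℂ) (ψ : Fin 2 × Fin 2 → ℂ) :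
    (multiplexer W₀ W₁).mulVec ψ = fun x =>
      (if x.1 = 0 then W₀ else W₁).mulVec ![ψ (x.1, 0), ψ (x.1, 1)] x.2 := by
  funext ⟨i, j⟩
  fin_cases i <;> simp [Matrix.mulVec, dotProduct, multiplexer, Fintype.sum_prod_type]

theorem exchange_multiplexer_mulVec (W₀ W₁ : Matrix (Fin 2) (Fin 2) ℂ) (ψ : Fin 2 × Fin 2 → ℂ) :
    (QLens.exchange.op (multiplexer W₀ W₁)).mulVec ψ = fun x =>
      (if x.2 = 0 then W₀ else W₁).mulVec ![ψ (0, x.2), ψ (1, x.2)] x.1 := by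
  funext ⟨i, j⟩
  rw [QLens.op_mulVec]
  fin_cases j <;> simp [Matrix.mulVec, dotProduct, multiplexer, Fintype.sum_prod_type,
    QLens.exchange]

namespace Synthesizable

/-- One elimination step: a multiplexer multiplied on the left is undone by its inverse, again a
multiplexer, at the cost of seven gates. -/
theorem of_multiplexer_mul (W₀ W₁ : Matrix.unitaryGroup (Fin 2) ℂ) {k : ℕ}
    {M : Matrix (Fin 2 × Fin 2) (Fin 2 × Fin 2) ℂ}
    (h : Synthesizable k (_root_.multiplexer W₀.1 W₁.1 * M)) : Synthesizable (7 + k) M := by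
  have h₀ : (W₀⁻¹).1 * W₀.1 = 1 := Matrix.UnitaryGroup.star_mul_self W₀
  have h₁ : (W₁⁻¹).1 * W₁.1 = 1 := Matrix.UnitaryGroup.star_mul_self W₁
  have := (multiplexer W₀⁻¹ W₁⁻¹).mul h
  rwa [← mul_assoc, multiplexer_mul, h₀, h₁, multiplexer_one, one_mul] at this

theorem of_exchange_multiplexer_mul (W₀ W₁ : Matrix.unitaryGroup (Fin 2) ℂ) {k : ℕ}
    {M : Matrix (Fin 2 × Fin 2) (Fin 2 × Fin 2) ℂ}
    (h : Synthesizable k (QLens.exchange.op (_root_.multiplexer W₀.1 W₁.1) * M)) :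
    Synthesizable (7 + k) M := by
  have h₀ : (W₀⁻¹).1 * W₀.1 = 1 := Matrix.UnitaryGroup.star_mul_self W₀
  have h₁ : (W₁⁻¹).1 * W₁.1 = 1 := Matrix.UnitaryGroup.star_mul_self W₁
  have := (multiplexer W₀⁻¹ W₁⁻¹).exchange.mul h
  rwa [← mul_assoc, ← QLens.op_mul, multiplexer_mul, h₀, h₁, multiplexer_one, QLens.op_one,
    one_mul] at this

end Synthesizable

theorem multiplexer_mul_apply (W₀ W₁ : Matrix (Fin 2) (Fin 2) ℂ)
    (M : Matrix (Fin 2 × Fin 2) (Fin 2 × Fin 2) ℂ) (x y : Fin 2 × Fin 2) :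
    (multiplexer W₀ W₁ * M) x y =
      (if x.1 = 0 then W₀ else W₁).mulVec ![M (x.1, 0) y, M (x.1, 1) y] x.2 :=
  congrFun (multiplexer_mulVec W₀ W₁ fun z => M z y) x

theorem exchange_multiplexer_mul_apply (W₀ W₁ : Matrix (Fin 2) (Fin 2) ℂ)
    (M : Matrix (Fin 2 × Fin 2) (Fin 2 × Fin 2) ℂ) (x y : Fin 2 × Fin 2) :
    (QLens.exchange.op (multiplexer W₀ W₁) * M) x y =
      (if x.2 = 0 then W₀ else W₁).mulVec ![M (0, x.2) y, M (1, x.2) y] x.1 :=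
  congrFun (exchange_multiplexer_mulVec W₀ W₁ fun z => M z y) x

theorem exchange_multiplexer_mem_unitary (W₀ W₁ : Matrix.unitaryGroup (Fin 2) ℂ) :
    QLens.exchange.op (multiplexer W₀.1 W₁.1) ∈ Matrix.unitaryGroup (Fin 2 × Fin 2) ℂ := by
  rw [Matrix.mem_unitaryGroup_iff, Matrix.star_eq_conjTranspose,
    QLens.op_conjTranspose, ← QLens.op_mul, ← Matrix.star_eq_conjTranspose,
    Matrix.mem_unitaryGroup_iff.1 (multiplexer_mem_unitary W₀ W₁), QLens.op_one]

/-- Every two-qubit unitary is a product of 35 elementary gates. -/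
theorem synthesizable_of_unitary (U : Matrix.unitaryGroup (Fin 2 × Fin 2) ℂ) :
    Synthesizable 35 U.1 := by
  have hU := U.2
  generalize U.1 = U at hU
  -- Two multiplexers clear column `(0, 0)` and two more clear column `(0, 1)`. What remains is a
  -- multiplexer, so five of them suffice and `35 = 5 * 7`.
  obtain ⟨W₀, r₀, h₀⟩ := exists_unitary_mulVec_eq (U (0, 0) (0, 0)) (U (0, 1) (0, 0))
  obtain ⟨W₁, r₁, h₁⟩ := exists_unitary_mulVec_eq (U (1, 0) (0, 0)) (U (1, 1) (0, 0))
  refine Synthesizable.of_multiplexer_mul W₀ W₁ (k := 28) ?_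
  have a₁ : ∀ i, (multiplexer W₀.1 W₁.1 * U) (i, 1) (0, 0) = 0 := by
    intro i
    rw [multiplexer_mul_apply]
    fin_cases i
    · simpa using congrFun h₀ 1
    · simpa using congrFun h₁ 1
  replace hU := mul_mem (multiplexer_mem_unitary W₀ W₁) hU
  generalize multiplexer W₀.1 W₁.1 * U = U at a₁ hU
  clear h₀ h₁ r₀ r₁ W₀ W₁
  obtain ⟨W, r, h⟩ := exists_unitary_mulVec_eq (U (0, 0) (0, 0)) (U (1, 0) (0, 0))
  refine Synthesizable.of_exchange_multiplexer_mul W 1 (k := 21) ?_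
  have a₂ : ∀ x, x ≠ (0, 0) →
      (QLens.exchange.op (multiplexer W.1 (1 : Matrix.unitaryGroup (Fin 2) ℂ).1) * U) x (0, 0)
        = 0 := by
    rintro ⟨i, j⟩ hx
    rw [exchange_multiplexer_mul_apply]
    fin_cases j
    · fin_cases i
      · exact absurd rfl hx
      · simpa using congrFun h 1
    · fin_cases i <;> simp [a₁]
  replace hU := mul_mem (exchange_multiplexer_mem_unitary W 1) hU
  generalize QLens.exchange.op (multiplexer W.1 (1 : Matrix.unitaryGroup (Fin 2) ℂ).1) * U = U
    at a₂ hU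
  clear a₁ h r W
  obtain ⟨W, r, h⟩ := exists_unitary_mulVec_eq (U (1, 0) (0, 1)) (U (1, 1) (0, 1))
  -- The cleared column also clears its row, so column `(0, 1)` starts with only three entries.
  have b₂ := unitary_row_eq_zero hU (0, 0) a₂
  -- The extra X leaves the surviving entry at `(1, 1)`, where it shares the second bit with `(0,
  -- 1)`. The next multiplexer can then combine the two and be the identity on second bit zero,
  -- preserving the first column.
  refine Synthesizable.of_multiplexer_mul 1 (pauliX * W) (k := 14) ?_
  have hXW : (pauliX * W).1.mulVec ![U (1, 0) (0, 1), U (1, 1) (0, 1)] = ![0, r] := by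
    change (pauliX.1 * W.1).mulVec _ = _
    rw [← Matrix.mulVec_mulVec, h]
    funext i
    fin_cases i <;> simp [pauliX, Matrix.mulVec, dotProduct]
  have a₃ : ∀ x, x ≠ (0, 0) → (multiplexer (1 : Matrix.unitaryGroup (Fin 2) ℂ).1
      (pauliX * W).1 * U) x (0, 0) = 0 := by
    rintro ⟨i, j⟩ hx
    rw [multiplexer_mul_apply]
    fin_cases i
    · fin_cases j
      · exact absurd rfl hx
      · simp [a₂]
    · fin_cases j <;> simp [a₂, Matrix.mulVec, dotProduct]
  have b₃ : ∀ i, (multiplexer (1 : Matrix.unitaryGroup (Fin 2) ℂ).1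
      (pauliX * W).1 * U) (i, 0) (0, 1) = 0 := by
    intro i
    rw [multiplexer_mul_apply]
    fin_cases i
    · simp [b₂]
    · simpa using congrFun hXW 0
  replace hU := mul_mem (multiplexer_mem_unitary 1 (pauliX * W)) hU
  generalize multiplexer (1 : Matrix.unitaryGroup (Fin 2) ℂ).1 (pauliX * W).1 * U = U
    at a₃ b₃ hU
  clear a₂ b₂ hXW h r W
  obtain ⟨W, r, h⟩ := exists_unitary_mulVec_eq (U (0, 1) (0, 1)) (U (1, 1) (0, 1))
  refine Synthesizable.of_exchange_multiplexer_mul 1 W (k := 7) ?_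
  have a₄ : ∀ x, x ≠ (0, 0) →
      (QLens.exchange.op (multiplexer (1 : Matrix.unitaryGroup (Fin 2) ℂ).1 W.1) * U) x (0, 0)
        = 0 := by
    rintro ⟨i, j⟩ hx
    rw [exchange_multiplexer_mul_apply]
    fin_cases j
    · fin_cases i
      · exact absurd rfl hx
      · simp [a₃]
    · fin_cases i <;> simp [a₃, Matrix.mulVec, dotProduct]
  have b₄ : ∀ x, x ≠ (0, 1) →
      (QLens.exchange.op (multiplexer (1 : Matrix.unitaryGroup (Fin 2) ℂ).1 W.1) * U) x (0, 1)
        = 0 := by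
    rintro ⟨i, j⟩ hx
    rw [exchange_multiplexer_mul_apply]
    fin_cases j
    · fin_cases i <;> simp [b₃]
    · fin_cases i
      · exact absurd rfl hx
      · simpa using congrFun h 1
  replace hU := mul_mem (exchange_multiplexer_mem_unitary 1 W) hU
  generalize QLens.exchange.op (multiplexer (1 : Matrix.unitaryGroup (Fin 2) ℂ).1 W.1) * U = U
    at a₄ b₄ hU
  have c₄ := unitary_row_eq_zero hU _ a₄
  have d₄ := unitary_row_eq_zero hU _ b₄
  -- Two diagonal columns kill one off-diagonal block; the corresponding rows, diagonal by
  -- unitarity, kill the other.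
  obtain ⟨V₀, V₁, rfl⟩ := exists_eq_multiplexer hU (by
    rintro ⟨i, j⟩ ⟨k, l⟩ hik
    fin_cases k
    · fin_cases l
      · exact a₄ _ fun h => hik (congrArg Prod.fst h)
      · exact b₄ _ fun h => hik (congrArg Prod.fst h)
    · have hi : i = 0 := by
        fin_cases i
        · rfl
        · exact absurd rfl hik
      subst hi
      fin_cases j
      · exact c₄ _ fun h => hik (congrArg Prod.fst h).symm
      · exact d₄ _ fun h => hik (congrArg Prod.fst h).symm)
  exact Synthesizable.multiplexer V₀ V₁
end

/-! ### CNOT layers as additive maps of bit strings, translations and pattern projections. -/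

noncomputable section

/-- The operator of a map of basis states. -/
def mapOp {X : Type} [DecidableEq X] (f : X → X) : Matrix X X ℂ :=
  fun x y => if x = f y then 1 else 0

theorem mapOp_mul {X : Type} [Fintype X] [DecidableEq X] (f g : X → X) :
    mapOp f * mapOp g = mapOp (f ∘ g) := by
  ext x y
  simp [Matrix.mul_apply, mapOp]

theorem mapOp_id {X : Type} [DecidableEq X] : mapOp (id : X → X) = 1 := by
  ext x y
  simp [mapOp, Matrix.one_apply]

theorem Fin.two_add_self (a : Fin 2) : a + a = 0 := by
  fin_cases a <;> rfl

/-- The layer with the given gates, provided that their supports are disjoint. -/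
def QLayer.ofGates {Q : Type} [Fintype Q] [DecidableEq Q] (l : List (QGate Q)) : QLayer Q :=
  open Classical in
  if h : l.Pairwise fun g h => Disjoint g.support h.support then ⟨l, h⟩ else ⟨[], List.Pairwise.nil⟩

section

variable {Q : Type} [Fintype Q] [DecidableEq Q]

theorem QLayer.gates_ofGates {l : List (QGate Q)}
    (h : l.Pairwise fun g h => Disjoint g.support h.support) : (QLayer.ofGates l).gates = l := by
  rw [QLayer.ofGates, dif_pos h]

theorem QLayer.mem_of_mem_ofGates {l : List (QGate Q)} {g : QGate Q}
    (h : g ∈ (QLayer.ofGates l).gates) : g ∈ l := by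
  unfold QLayer.ofGates at h
  split_ifs at h with h'
  · exact h
  · simp at h

/-- The CNOT gate with control `p` and target `q`. -/
def cnotGate (p q : Q) : QGate Q :=
  if h : p ≠ q then QGate.two p q h cnotUnitary else QGate.one q 1

theorem cnotGate_isCnotOrSingle (p q : Q) : (cnotGate p q).IsCnotOrSingle := by
  unfold cnotGate
  split_ifs <;> simp [QGate.IsCnotOrSingle, cnotUnitary]

theorem support_cnotGate_subset (p q : Q) : (cnotGate p q).support ⊆ {p, q} := by
  unfold cnotGate
  split_ifs <;> simp [QGate.support]

/-- The additive map of a list of CNOT gates; the head of the list is applied last. -/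
def cnotMap : List (Q × Q) → QBasis Q →+ QBasis Q
  | [] => AddMonoidHom.id _
  | p :: l => (AddMonoidHom.id _ + (AddMonoidHom.single (fun _ : Q => Fin 2) p.2).comp
      (Pi.evalAddMonoidHom (fun _ : Q => Fin 2) p.1)).comp (cnotMap l)

theorem cnotMap_cons (p : Q × Q) (l : List (Q × Q)) (x : QBasis Q) :
    cnotMap (p :: l) x = cnotMap l x + Pi.single p.2 (cnotMap l x p.1) := rfl

theorem toMatrix_cnotGate {p q : Q} (h : p ≠ q) :
    (cnotGate p q).toMatrix = mapOp fun x : QBasis Q => x + Pi.single q (x p) := by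
  rw [cnotGate, dif_pos h]
  ext x y
  simp only [QGate.toMatrix, cnotUnitary, cnotMatrix, mapOp]
  rw [← ite_and]
  congr 1
  simp only [Prod.mk.injEq, eq_iff_iff]
  constructor
  · rintro ⟨h₁, h₂, h₃⟩
    funext r
    by_cases hrq : r = q
    · subst hrq; simpa using h₃
    · by_cases hrp : r = p
      · subst hrp; simpa [hrq] using h₂
      · simpa [hrq] using h₁ r hrp hrq
  · rintro rfl
    refine ⟨fun r _ hrq => ?_, ?_, ?_⟩
    · simp [hrq]
    · simp [h]
    · simp

theorem gatesOp_cnotGate {l : List (Q × Q)} (h : ∀ p ∈ l, p.1 ≠ p.2) :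
    gatesOp (l.map fun p => cnotGate p.1 p.2) = mapOp (cnotMap l) := by
  induction l with
  | nil => exact mapOp_id.symm
  | cons p l ih =>
    rw [List.map_cons, gatesOp_cons, ih fun p hp => h p (List.mem_cons_of_mem _ hp),
      toMatrix_cnotGate (h p List.mem_cons_self), mapOp_mul]
    rfl

theorem cnotMap_apply_of_notMem {l : List (Q × Q)} {r : Q} (h : ∀ p ∈ l, p.2 ≠ r)
    (x : QBasis Q) : cnotMap l x r = x r := by
  induction l with
  | nil => rfl
  | cons p l ih =>
    rw [cnotMap_cons, Pi.add_apply, Pi.single_eq_of_ne (h p List.mem_cons_self).symm, add_zero,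
      ih fun p hp => h p (List.mem_cons_of_mem _ hp)]

/-- No target is a source or a target of another pair, so every source is read at its original
value. Sources may coincide. -/
theorem cnotMap_apply_of_mem {l : List (Q × Q)} (hl : ∀ p ∈ l, p.1 ≠ p.2)
    (hp : l.Pairwise fun p p' => p.1 ≠ p'.2 ∧ p.2 ≠ p'.1 ∧ p.2 ≠ p'.2) {p : Q × Q} (h : p ∈ l)
    (x : QBasis Q) : cnotMap l x p.2 = x p.2 + x p.1 := by
  induction l with
  | nil => simp at h
  | cons a l ih =>
    rw [List.pairwise_cons] at hp
    rw [cnotMap_cons, Pi.add_apply]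
    rcases List.mem_cons.1 h with rfl | h'
    · rw [Pi.single_eq_same, cnotMap_apply_of_notMem fun a ha => (hp.1 a ha).2.2.symm,
        cnotMap_apply_of_notMem fun a ha => (hp.1 a ha).1.symm]
    · rw [Pi.single_eq_of_ne (hp.1 p h').2.2.symm, add_zero,
        ih (fun p hp => hl p (List.mem_cons_of_mem _ hp)) hp.2 h']

/-- The sources are unchanged by the layer, so a second pass adds the same bits again, and these
cancel mod 2. -/
theorem cnotMap_cnotMap {l : List (Q × Q)} (hl : ∀ p ∈ l, p.1 ≠ p.2)
    (hp : l.Pairwise fun p p' => p.1 ≠ p'.2 ∧ p.2 ≠ p'.1 ∧ p.2 ≠ p'.2) (x : QBasis Q) :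
    cnotMap l (cnotMap l x) = x := by
  funext r
  by_cases h : ∃ p ∈ l, p.2 = r
  · obtain ⟨p, hpl, rfl⟩ := h
    have hs : ∀ a ∈ l, a.2 ≠ p.1 := by
      intro a ha
      by_cases hap : a = p
      · subst hap; exact (hl _ ha).symm
      · have hp' : l.Pairwise fun p p' => p.1 ≠ p'.2 ∧ p.2 ≠ p'.1 := hp.imp fun h => ⟨h.1, h.2.1⟩
        haveI : Std.Symm fun p p' : Q × Q => p.1 ≠ p'.2 ∧ p.2 ≠ p'.1 :=
          ⟨fun a b h => ⟨h.2.symm, h.1.symm⟩⟩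
        exact (hp'.forall ha hpl hap).2
    rw [cnotMap_apply_of_mem hl hp hpl, cnotMap_apply_of_mem hl hp hpl,
      cnotMap_apply_of_notMem hs, add_assoc, Fin.two_add_self, add_zero]
  · push Not at h
    rw [cnotMap_apply_of_notMem h, cnotMap_apply_of_notMem h]

/-- The translation of the basis states by `v`. -/
def translation (v : QBasis Q) : QOp Q := mapOp fun x => x + v

theorem toMatrix_pauliX (q : Q) :
    (QGate.one q pauliX).toMatrix = translation (Pi.single q 1) := by
  ext x y
  simp only [QGate.toMatrix, translation, mapOp]
  have key : ∀ a b : Fin 2, pauliX.1 a b = if a = b + 1 then 1 else 0 := by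
    intro a b
    fin_cases a <;> fin_cases b <;> simp [pauliX]
  rw [key, ← ite_and]
  congr 1
  rw [eq_iff_iff]
  constructor
  · rintro ⟨h₁, h₂⟩
    funext r
    by_cases hrq : r = q
    · subst hrq; simpa using h₂
    · simpa [hrq] using h₁ r hrq
  · rintro rfl
    exact ⟨fun r hr => by simp [hr], by simp⟩

theorem gatesOp_pauliX {l : List Q} (h : l.Nodup) :
    gatesOp (l.map fun q => QGate.one q pauliX) = translation fun q => if q ∈ l then 1 else 0 := by
  induction l with
  | nil =>
    have : (fun x : QBasis Q => x + fun q => if q ∈ ([] : List Q) then 1 else 0) = id := by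
      funext x r; simp
    rw [translation, this, mapOp_id]; rfl
  | cons a l ih =>
    rw [List.nodup_cons] at h
    rw [List.map_cons, gatesOp_cons, ih h.2, toMatrix_pauliX, translation, translation, mapOp_mul,
      translation]
    congr 1
    funext x r
    by_cases hr : r = a
    · subst hr; simp [h.1]
    · simp [hr]

/-- The projection onto the basis states that agree with `v` on `K`. -/
def patternProj (K : Finset Q) (v : QBasis Q) : QOp Q :=
  Matrix.diagonal fun x => if ∀ q ∈ K, x q = v q then 1 else 0

theorem QGate.eq_of_toMatrix_ne_zero {g : QGate Q} {x y : QBasis Q} (h : g.toMatrix x y ≠ 0)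
    {r : Q} (hr : r ∉ g.support) : x r = y r := by
  cases g with
  | one q U =>
    simp only [QGate.toMatrix, ne_eq, ite_eq_right_iff, Classical.not_imp] at h
    exact h.1 r (by simpa [QGate.support] using hr)
  | two p q hpq U =>
    simp only [QGate.toMatrix, ne_eq, ite_eq_right_iff, Classical.not_imp] at h
    simp only [QGate.support, Finset.mem_insert, Finset.mem_singleton, not_or] at hr
    exact h.1 r hr.1 hr.2

/-- A nonzero entry of a gate matrix joins basis states that agree off its support, hence on `K`. -/
theorem commute_patternProj {g : QGate Q} {K : Finset Q} (h : Disjoint g.support K)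
    (v : QBasis Q) : Commute g.toMatrix (patternProj K v) := by
  ext x y
  rw [patternProj, Matrix.mul_diagonal, Matrix.diagonal_mul]
  by_cases hxy : g.toMatrix x y = 0
  · simp [hxy]
  · have : (∀ q ∈ K, x q = v q) ↔ ∀ q ∈ K, y q = v q := forall₂_congr fun q hq => by
      rw [QGate.eq_of_toMatrix_ne_zero hxy (Finset.disjoint_right.1 h hq)]
    simp only [this, mul_comm]

theorem gatesOp_commute_patternProj {l : List (QGate Q)} {K : Finset Q}
    (h : ∀ g ∈ l, Disjoint g.support K) (v : QBasis Q) :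
    Commute (gatesOp l) (patternProj K v) := by
  refine Commute.list_prod_left _ _ fun M hM => ?_
  obtain ⟨g, hg, rfl⟩ := List.mem_map.1 hM
  exact commute_patternProj (h g hg) v

theorem mapOp_mul_patternProj {f g : QBasis Q → QBasis Q} {K : Finset Q} {v : QBasis Q}
    (h : ∀ x : QBasis Q, (∀ q ∈ K, x q = v q) → f x = g x) :
    mapOp f * patternProj K v = mapOp g * patternProj K v := by
  ext x y
  rw [patternProj, Matrix.mul_diagonal, Matrix.mul_diagonal, mapOp, mapOp]
  by_cases hy : ∀ q ∈ K, y q = v q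
  · rw [h y hy]
  · simp [hy]

/-- Phase kickback: on a fixed pattern a diagonal gate on a control qubit is a scalar. The scalars
lost in the gate templates are restored in this way. -/
theorem phase_mul_patternProj {K : Finset Q} (v : QBasis Q) {q : Q} (hq : q ∈ K) (z : Circle) :
    (QGate.one q (phaseUnitary z)).toMatrix * patternProj K v =
      (if v q = 0 then 1 else (z : ℂ)) • patternProj K v := by
  have : (QGate.one q (phaseUnitary z)).toMatrix =
      Matrix.diagonal fun x : QBasis Q => if x q = 0 then 1 else (z : ℂ) := by
    have key : ∀ a b : Fin 2, (phaseUnitary z).1 a b =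
        if a = b then (if a = 0 then 1 else (z : ℂ)) else 0 := by
      intro a b
      fin_cases a <;> fin_cases b <;> simp [phaseUnitary]
    ext x y
    simp only [QGate.toMatrix, Matrix.diagonal_apply, key]
    rw [← ite_and]
    congr 1
    rw [eq_iff_iff]
    constructor
    · rintro ⟨h₁, h₂⟩
      funext r
      by_cases hr : r = q
      · rw [hr, h₂]
      · exact h₁ r hr
    · rintro rfl
      exact ⟨fun _ _ => rfl, rfl⟩
  rw [this, patternProj, Matrix.diagonal_mul_diagonal, ← Matrix.diagonal_smul]
  congr 1
  funext x
  by_cases hx : ∀ q ∈ K, x q = v q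
  · simp [hx q hq]
  · simp [hx]

end
end

/-! ### Binary fan-out trees. -/

noncomputable section

section

variable {Q : Type} [Fintype Q] [DecidableEq Q]

/-- The source-target pairs in level `k` of the binary fan-out trees of height `L` on
`τ 0, …, τ (r - 1)`, one tree for each block of `2 ^ L` consecutive indices. -/
def treePairs (τ : ℕ → Q) (L r k : ℕ) : List (Q × Q) :=
  ((List.range r).filter fun i => i % 2 ^ L < 2 ^ k ∧ i + 2 ^ k < r).map
    fun i => (τ i, τ (i + 2 ^ k))

/-- One level of the fan-out trees. -/
def treeLayer (τ : ℕ → Q) (L r k : ℕ) : QLayer Q :=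
  QLayer.ofGates ((treePairs τ L r k).map fun p => cnotGate p.1 p.2)

/-- The fan-out trees. -/
def treeCircuit (τ : ℕ → Q) (L r : ℕ) : QCircuit Q :=
  (List.range L).map (treeLayer τ L r)

open Classical in
/-- The indicator vector of the nodes that are reached before level `k`. -/
def treeIndicator (τ : ℕ → Q) (L r k : ℕ) : QBasis Q :=
  fun q => if ∃ i < r, i % 2 ^ L < 2 ^ k ∧ τ i = q then 1 else 0

theorem mod_add_of_lt {i c m : ℕ} (h : i % m + c < m) : (i + c) % m = i % m + c := by
  rw [Nat.add_mod, Nat.mod_eq_of_lt (a := c) (by omega), Nat.mod_eq_of_lt h]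

theorem mod_add_two_pow {i k L : ℕ} (hk : k < L) (h : i % 2 ^ L < 2 ^ k) :
    (i + 2 ^ k) % 2 ^ L = i % 2 ^ L + 2 ^ k := by
  apply mod_add_of_lt
  have : 2 ^ (k + 1) ≤ 2 ^ L := Nat.pow_le_pow_right (by norm_num) hk
  rw [pow_succ] at this
  omega

theorem sub_mod_of_le {j c m : ℕ} (hm : 0 < m) (h : c ≤ j % m) : (j - c) % m = j % m - c := by
  have h₁ : j - c = j % m - c + m * (j / m) := by
    have := Nat.mod_add_div j m
    generalize m * (j / m) = t at *
    generalize j % m = a at *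
    omega
  have h₂ : j % m < m := Nat.mod_lt _ hm
  rw [h₁, Nat.add_mul_mod_self_left]
  exact Nat.mod_eq_of_lt (by omega)

variable {τ : ℕ → Q} {L r : ℕ}

theorem mem_treePairs {k : ℕ} {p : Q × Q} : p ∈ treePairs τ L r k ↔
    ∃ i, i % 2 ^ L < 2 ^ k ∧ i + 2 ^ k < r ∧ (τ i, τ (i + 2 ^ k)) = p := by
  simp only [treePairs, List.mem_map, List.mem_filter, List.mem_range, decide_eq_true_eq]
  constructor
  · rintro ⟨i, ⟨_, h₁, h₂⟩, h₃⟩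
    exact ⟨i, h₁, h₂, h₃⟩
  · rintro ⟨i, h₁, h₂, h₃⟩
    exact ⟨i, ⟨by omega, h₁, h₂⟩, h₃⟩

theorem treePairs_ne (hτ : ∀ i < r, ∀ j < r, τ i = τ j → i = j) {k : ℕ} :
    ∀ p ∈ treePairs τ L r k, p.1 ≠ p.2 := by
  intro p hp h
  obtain ⟨i, h₁, h₂, rfl⟩ := mem_treePairs.1 hp
  have := hτ i (by omega) (i + 2 ^ k) h₂ h
  have : 0 < 2 ^ k := by positivity
  omega

/-- Modulo `2 ^ L`, sources have residue below `2 ^ k` and targets have residue in `[2 ^ k, 2 ^ (k +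
1))`. So no qubit plays both roles, and a level is a legitimate layer. -/
theorem treePairs_pairwise (hτ : ∀ i < r, ∀ j < r, τ i = τ j → i = j) {k : ℕ} (hk : k < L) :
    (treePairs τ L r k).Pairwise
      fun p p' => p.1 ≠ p'.1 ∧ p.1 ≠ p'.2 ∧ p.2 ≠ p'.1 ∧ p.2 ≠ p'.2 := by
  rw [treePairs, List.pairwise_map]
  refine (List.nodup_range.filter _).pairwise_of_forall_ne fun i hi j hj hij => ?_
  simp only [List.mem_filter, List.mem_range, decide_eq_true_eq] at hi hj
  have hi' := mod_add_two_pow hk hi.2.1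
  have hj' := mod_add_two_pow hk hj.2.1
  refine ⟨fun h => ?_, fun h => ?_, fun h => ?_, fun h => ?_⟩
  · exact hij (hτ i hi.1 j hj.1 h)
  · have := hτ i hi.1 _ hj.2.2 h
    rw [← this] at hj'
    omega
  · have := hτ _ hi.2.2 j hj.1 h
    rw [this] at hi'
    omega
  · have := hτ _ hi.2.2 _ hj.2.2 h
    omega

theorem cnotGates_pairwise_disjoint {l : List (Q × Q)} (h : l.Pairwise
      fun p p' => p.1 ≠ p'.1 ∧ p.1 ≠ p'.2 ∧ p.2 ≠ p'.1 ∧ p.2 ≠ p'.2) :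
    (l.map fun p => cnotGate p.1 p.2).Pairwise fun g h => Disjoint g.support h.support := by
  rw [List.pairwise_map]
  refine h.imp fun {p p'} h => ?_
  refine Disjoint.mono (support_cnotGate_subset _ _) (support_cnotGate_subset _ _) ?_
  simp [h.1.symm, h.2.1.symm, h.2.2.1.symm, h.2.2.2.symm]

theorem toMatrix_treeLayer (hτ : ∀ i < r, ∀ j < r, τ i = τ j → i = j) {k : ℕ} (hk : k < L) :
    (treeLayer τ L r k).toMatrix = mapOp (cnotMap (treePairs τ L r k)) := by
  rw [QLayer.toMatrix_eq, treeLayer,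
    QLayer.gates_ofGates (cnotGates_pairwise_disjoint (treePairs_pairwise hτ hk)),
    gatesOp_cnotGate (treePairs_ne hτ)]

/-- Each level doubles the set of reached residues in every block: a newly reached index `j` was
zero and receives the one at `j - 2 ^ k`. Truncation at `r` is harmless because `j - 2 ^ k` is
smaller than `j`. -/
theorem cnotMap_treeIndicator (hτ : ∀ i < r, ∀ j < r, τ i = τ j → i = j) {k : ℕ} (hk : k < L) :
    cnotMap (treePairs τ L r k) (treeIndicator τ L r k) = treeIndicator τ L r (k + 1) := by
  have hpow : 2 ^ (k + 1) = 2 ^ k + 2 ^ k := by ring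
  have hpos : 0 < 2 ^ k := by positivity
  funext q
  by_cases hq : ∃ p ∈ treePairs τ L r k, p.2 = q
  · obtain ⟨p, hp, rfl⟩ := hq
    rw [cnotMap_apply_of_mem (treePairs_ne hτ) ((treePairs_pairwise hτ hk).imp
      fun h => ⟨h.2.1, h.2.2.1, h.2.2.2⟩) hp]
    obtain ⟨i, h₁, h₂, rfl⟩ := mem_treePairs.1 hp
    have h₃ := mod_add_two_pow hk h₁
    have h₄ : ¬ ∃ j < r, j % 2 ^ L < 2 ^ k ∧ τ j = τ (i + 2 ^ k) := by
      rintro ⟨j, hj, hj', hji⟩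
      rw [hτ j hj _ h₂ hji] at hj'
      omega
    have h₅ : ∃ j < r, j % 2 ^ L < 2 ^ k ∧ τ j = τ i := ⟨i, by omega, h₁, rfl⟩
    have h₆ : ∃ j < r, j % 2 ^ L < 2 ^ (k + 1) ∧ τ j = τ (i + 2 ^ k) :=
      ⟨_, h₂, by omega, rfl⟩
    simp only [treeIndicator, if_neg h₄, if_pos h₅, if_pos h₆, zero_add]
  · push Not at hq
    rw [cnotMap_apply_of_notMem hq]
    simp only [treeIndicator]
    congr 1
    rw [eq_iff_iff]
    constructor
    · rintro ⟨i, h₁, h₂, h₃⟩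
      exact ⟨i, h₁, by omega, h₃⟩
    · rintro ⟨j, h₁, h₂, rfl⟩
      by_contra hlt
      have h₃ : 2 ^ k ≤ j % 2 ^ L := by
        by_contra h₃
        exact hlt ⟨j, h₁, by omega, rfl⟩
      have h₄ := sub_mod_of_le (by positivity) h₃
      have h₅ : j % 2 ^ L ≤ j := Nat.mod_le _ _
      refine hq (τ (j - 2 ^ k), τ (j - 2 ^ k + 2 ^ k))
        (mem_treePairs.2 ⟨j - 2 ^ k, by omega, by omega, rfl⟩) ?_
      change τ _ = τ j
      congr 1
      omega

/-- Additivity of `f` is what makes the tree conjugate translations to translations. The value on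
the root indicator says where the roots spread, the third clause covers a control that is off, and
the last two hold because every level is an involution. -/
theorem treeCircuit_spec (hτ : ∀ i < r, ∀ j < r, τ i = τ j → i = j) {k : ℕ} (hk : k ≤ L) :
    ∃ f : QBasis Q →+ QBasis Q,
      QCircuit.toMatrix ((List.range k).map (treeLayer τ L r)) = mapOp f ∧
      f (treeIndicator τ L r 0) = treeIndicator τ L r k ∧
      (∀ x : QBasis Q, (∀ i < r, x (τ i) = 0) → f x = x) ∧
      QCircuit.toMatrix ((List.range k).map (treeLayer τ L r)).reverse * mapOp f = 1 ∧
      mapOp f * QCircuit.toMatrix ((List.range k).map (treeLayer τ L r)).reverse = 1 := by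
  induction k with
  | zero =>
    refine ⟨AddMonoidHom.id _, mapOp_id.symm, rfl, fun _ _ => rfl, ?_, ?_⟩
    · rw [show ⇑(AddMonoidHom.id (QBasis Q)) = id from rfl, mapOp_id]; simp [QCircuit.toMatrix]
    · rw [show ⇑(AddMonoidHom.id (QBasis Q)) = id from rfl, mapOp_id]; simp [QCircuit.toMatrix]
  | succ k ih =>
    obtain ⟨f, h₁, h₂, h₃, h₄, h₅⟩ := ih (by omega)
    set g := cnotMap (treePairs τ L r k) with hg
    have hgg : mapOp g * mapOp g = 1 := by
      rw [mapOp_mul, ← mapOp_id]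
      congr 1
      funext x
      exact cnotMap_cnotMap (treePairs_ne hτ) ((treePairs_pairwise hτ hk).imp
        fun h => ⟨h.2.1, h.2.2.1, h.2.2.2⟩) x
    have hl := toMatrix_treeLayer hτ (L := L) (k := k) hk
    have hgf : mapOp (g.comp f) = mapOp g * mapOp f := by rw [mapOp_mul]; rfl
    refine ⟨g.comp f, ?_, ?_, ?_, ?_, ?_⟩
    · rw [List.range_succ, List.map_append, QCircuit.toMatrix_append, h₁, hgf]
      simp [QCircuit.toMatrix, hl, hg]
    · rw [AddMonoidHom.comp_apply, h₂, hg, cnotMap_treeIndicator hτ hk]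
    · intro x hx
      rw [AddMonoidHom.comp_apply, h₃ x hx]
      funext q
      by_cases hq : ∃ p ∈ treePairs τ L r k, p.2 = q
      · obtain ⟨p, hp, rfl⟩ := hq
        rw [hg, cnotMap_apply_of_mem (treePairs_ne hτ) ((treePairs_pairwise hτ hk).imp
          fun h => ⟨h.2.1, h.2.2.1, h.2.2.2⟩) hp]
        obtain ⟨i, _, hi, rfl⟩ := mem_treePairs.1 hp
        rw [hx i (by omega), add_zero]
      · push Not at hq
        rw [hg, cnotMap_apply_of_notMem hq]
    · rw [List.range_succ, List.map_append, List.reverse_append, QCircuit.toMatrix_append, hgf]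
      simp only [List.map_cons, List.map_nil, List.reverse_singleton, QCircuit.toMatrix, hl,
        one_mul]
      rw [mul_assoc, ← mul_assoc (mapOp g), hgg, one_mul, h₄]
    · rw [List.range_succ, List.map_append, List.reverse_append, QCircuit.toMatrix_append, hgf]
      simp only [List.map_cons, List.map_nil, List.reverse_singleton, QCircuit.toMatrix, hl,
        one_mul]
      rw [mul_assoc, ← mul_assoc (mapOp f), h₅, one_mul, hgg]

theorem treeCircuit_usesCnotAndSingle : (treeCircuit τ L r).UsesCnotAndSingle := by
  intro l hl g hg
  obtain ⟨k, _, rfl⟩ := List.mem_map.1 hl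
  obtain ⟨p, _, rfl⟩ := List.mem_map.1 (QLayer.mem_of_mem_ofGates hg)
  exact cnotGate_isCnotOrSingle _ _

theorem QCircuit.usesCnotAndSingle_reverse {C : QCircuit Q} (h : C.UsesCnotAndSingle) :
    UsesCnotAndSingle (List.reverse C) :=
  fun l hl => h l (List.mem_reverse.1 hl)

theorem treeCircuit_support {g : QGate Q} {l : QLayer Q} (hl : l ∈ treeCircuit τ L r)
    (hg : g ∈ l.gates) : ∀ q ∈ g.support, ∃ i < r, τ i = q := by
  obtain ⟨k, _, rfl⟩ := List.mem_map.1 hl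
  obtain ⟨p, hp, rfl⟩ := List.mem_map.1 (QLayer.mem_of_mem_ofGates hg)
  obtain ⟨i, _, hi, rfl⟩ := mem_treePairs.1 hp
  intro q hq
  have := support_cnotGate_subset _ _ hq
  simp only [Finset.mem_insert, Finset.mem_singleton] at this
  rcases this with rfl | rfl
  · exact ⟨i, by omega, rfl⟩
  · exact ⟨_, hi, rfl⟩

theorem QCircuit.commute_toMatrix {C : QCircuit Q} {M : QOp Q}
    (h : ∀ l ∈ C, ∀ g ∈ l.gates, Commute g.toMatrix M) : Commute C.toMatrix M := by
  induction C with
  | nil => exact Commute.one_left _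
  | cons l C ih =>
    refine Commute.mul_left (ih fun l' hl' => h l' (List.mem_cons_of_mem _ hl')) ?_
    refine Commute.list_prod_left _ _ fun N hN => ?_
    obtain ⟨g, hg, rfl⟩ := List.mem_map.1 hN
    exact h l List.mem_cons_self g hg

/-- The Pauli gate `X ^ b` on the qubit `q`. -/
def pauliPower (b : Fin 2) (q : Q) : List (QGate Q) :=
  if b = 0 then [] else [QGate.one q pauliX]

/-- The CNOT pairs that feed the roots of the fan-out trees. -/
def rootPairs (τ κ : ℕ → Q) (L r : ℕ) : List (Q × Q) :=
  ((List.range r).filter fun i => i % 2 ^ L = 0).map fun i => (κ (i / 2 ^ L), τ i)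

/-- The circuit that adds `κ (i / 2 ^ L)` to `τ i` for all `i < r` while the gates `e` are
applied to other qubits. -/
def fanOut (τ κ : ℕ → Q) (L r : ℕ) (e : List (QGate Q)) : QCircuit Q :=
  (treeCircuit τ L r).reverse ++
    [QLayer.ofGates (((rootPairs τ κ L r).map fun p => cnotGate p.1 p.2) ++ e)] ++
    treeCircuit τ L r

theorem depth_fanOut (τ κ : ℕ → Q) (L r : ℕ) (e : List (QGate Q)) :
    (fanOut τ κ L r e).depth = 2 * L + 1 := by
  simp [fanOut, QCircuit.depth, treeCircuit]
  omega

theorem fanOut_usesCnotAndSingle (τ κ : ℕ → Q) (L r : ℕ) {e : List (QGate Q)}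
    (he : ∀ g ∈ e, g.IsCnotOrSingle) : (fanOut τ κ L r e).UsesCnotAndSingle := by
  refine QCircuit.usesCnotAndSingle_append (QCircuit.usesCnotAndSingle_append
    (QCircuit.usesCnotAndSingle_reverse treeCircuit_usesCnotAndSingle) ?_)
    treeCircuit_usesCnotAndSingle
  intro l hl g hg
  rw [List.mem_singleton] at hl
  subst hl
  rcases List.mem_append.1 (QLayer.mem_of_mem_ofGates hg) with h | h
  · obtain ⟨p, _, rfl⟩ := List.mem_map.1 h
    exact cnotGate_isCnotOrSingle _ _
  · exact he g h

theorem mem_rootPairs {κ : ℕ → Q} {p : Q × Q} : p ∈ rootPairs τ κ L r ↔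
    ∃ i < r, i % 2 ^ L = 0 ∧ (κ (i / 2 ^ L), τ i) = p := by
  simp [rootPairs, and_assoc]

/-- On the pattern `b` the root CNOTs are just `X ^ b` on the roots, and conjugation by the trees
carries this to every node. The gates `e` avoid the trees, so they fit into the middle layer at no
cost in depth. -/
theorem fanOut_mul_patternProj {κ : ℕ → Q} {K : Finset Q} {e : List (QGate Q)}
    (hτ : ∀ i < r, ∀ j < r, τ i = τ j → i = j) (hτK : ∀ i < r, τ i ∉ K)
    (hκ : ∀ i < r, ∀ j < r, κ (i / 2 ^ L) = κ (j / 2 ^ L) → i / 2 ^ L = j / 2 ^ L)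
    (hκK : ∀ i < r, κ (i / 2 ^ L) ∈ K)
    (he : e.Pairwise fun g h => Disjoint g.support h.support)
    (heτ : ∀ g ∈ e, ∀ i < r, τ i ∉ g.support) (heK : ∀ g ∈ e, Disjoint g.support K)
    (b : Fin 2) :
    (fanOut τ κ L r e).toMatrix * patternProj K (fun _ => b) =
      gatesOp (((List.range r).map τ).flatMap (pauliPower b)) * gatesOp e *
        patternProj K (fun _ => b) := by
  set P := patternProj K (fun _ => b) with hP
  obtain ⟨f, h₁, h₂, -, h₄, h₅⟩ := treeCircuit_spec (L := L) hτ le_rfl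
  have hne : ∀ p ∈ rootPairs τ κ L r, p.1 ≠ p.2 := by
    intro p hp h
    obtain ⟨i, hi, -, rfl⟩ := mem_rootPairs.1 hp
    exact hτK i hi ((show κ _ = τ i from h) ▸ hκK i hi)
  have hpw : (rootPairs τ κ L r).Pairwise
      fun p p' => p.1 ≠ p'.1 ∧ p.1 ≠ p'.2 ∧ p.2 ≠ p'.1 ∧ p.2 ≠ p'.2 := by
    rw [rootPairs, List.pairwise_map]
    refine (List.nodup_range.filter _).pairwise_of_forall_ne fun i hi j hj hij => ?_
    simp only [List.mem_filter, List.mem_range, decide_eq_true_eq] at hi hj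
    refine ⟨fun h => hij ?_, fun h => ?_, fun h => ?_, fun h => hij (hτ i hi.1 j hj.1 h)⟩
    · have := hκ i hi.1 j hj.1 h
      rw [← Nat.mod_add_div i (2 ^ L), ← Nat.mod_add_div j (2 ^ L), hi.2, hj.2, this]
    · exact hτK j hj.1 ((show κ _ = τ j from h) ▸ hκK i hi.1)
    · exact hτK i hi.1 ((show τ i = κ _ from h) ▸ hκK j hj.1)
  have hpw' : (rootPairs τ κ L r).Pairwise
      fun p p' => p.1 ≠ p'.2 ∧ p.2 ≠ p'.1 ∧ p.2 ≠ p'.2 :=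
    hpw.imp fun h => ⟨h.2.1, h.2.2.1, h.2.2.2⟩
  have hlayer : (QLayer.ofGates
      (((rootPairs τ κ L r).map fun p => cnotGate p.1 p.2) ++ e)).toMatrix =
      mapOp (cnotMap (rootPairs τ κ L r)) * gatesOp e := by
    rw [QLayer.toMatrix_eq, QLayer.gates_ofGates, gatesOp_append, gatesOp_cnotGate hne]
    rw [List.pairwise_append]
    refine ⟨cnotGates_pairwise_disjoint hpw, he, fun g hg g' hg' => ?_⟩
    obtain ⟨p, hp, rfl⟩ := List.mem_map.1 hg
    obtain ⟨i, hi, -, rfl⟩ := mem_rootPairs.1 hp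
    refine Disjoint.mono_left (support_cnotGate_subset _ _) ?_
    simp only [Finset.disjoint_insert_left, Finset.disjoint_singleton_left]
    exact ⟨Finset.disjoint_right.1 (heK g' hg') (hκK i hi), heτ g' hg' i hi⟩
  set T := (treeCircuit τ L r).toMatrix with hT
  set T' := QCircuit.toMatrix (treeCircuit τ L r).reverse with hT'
  have hT'e : Commute T' (gatesOp e) := by
    refine QCircuit.commute_toMatrix fun l hl g hg => ?_
    have : Commute (gatesOp [g]) (gatesOp e) := commute_gatesOp fun g₁ hg₁ g' hg' => by
      rw [List.mem_singleton] at hg₁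
      subst hg₁
      rw [Finset.disjoint_left]
      intro q hq
      obtain ⟨i, hi, rfl⟩ := treeCircuit_support (List.mem_reverse.1 hl) hg q hq
      exact heτ g' hg' i hi
    simpa using this
  have hT'P : Commute T' P := by
    refine QCircuit.commute_toMatrix fun l hl g hg => commute_patternProj ?_ _
    rw [Finset.disjoint_left]
    intro q hq
    obtain ⟨i, hi, rfl⟩ := treeCircuit_support (List.mem_reverse.1 hl) hg q hq
    exact hτK i hi
  have heP : Commute (gatesOp e) P := gatesOp_commute_patternProj heK _
  -- All sources lie in `K` and read `b`, so on this subspace the root CNOTs act as a fixed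
  -- translation.
  have hroot : mapOp (cnotMap (rootPairs τ κ L r)) * P =
      translation (if b = 0 then 0 else treeIndicator τ L r 0) * P := by
    refine mapOp_mul_patternProj fun x hx => ?_
    have hind : ∀ q, (if b = 0 then 0 else treeIndicator τ L r 0 : QBasis Q) q =
        if ∃ i < r, i % 2 ^ L = 0 ∧ τ i = q then b else 0 := by
      intro q
      have hb : b = 0 ∨ b = 1 := by fin_cases b <;> simp
      rcases hb with rfl | rfl
      · simp
      · simp [treeIndicator]
    funext q
    rw [Pi.add_apply, hind]
    by_cases hq : ∃ p ∈ rootPairs τ κ L r, p.2 = q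
    · obtain ⟨p, hp, rfl⟩ := hq
      rw [cnotMap_apply_of_mem hne hpw' hp]
      obtain ⟨i, hi, hi', rfl⟩ := mem_rootPairs.1 hp
      rw [if_pos ⟨i, hi, hi', rfl⟩, hx _ (hκK i hi)]
    · have hq' : ¬ ∃ i < r, i % 2 ^ L = 0 ∧ τ i = q := by
        rintro ⟨i, hi, hi', h⟩
        exact hq ⟨_, mem_rootPairs.2 ⟨i, hi, hi', rfl⟩, h⟩
      push Not at hq
      rw [cnotMap_apply_of_notMem hq, if_neg hq', add_zero]
  have htrans : ∀ v : QBasis Q, T * translation v = translation (f v) * T := by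
    intro v
    rw [show T = mapOp f from h₁, translation, translation, mapOp_mul, mapOp_mul]
    congr 1
    funext x
    exact f.map_add x v
  have hX : translation (f (if b = 0 then 0 else treeIndicator τ L r 0)) =
      gatesOp (((List.range r).map τ).flatMap (pauliPower b)) := by
    have hb : b = 0 ∨ b = 1 := by fin_cases b <;> simp
    rcases hb with rfl | rfl
    · have : (fun x : QBasis Q => x + 0) = id := by funext x; simp
      have hfm : ∀ l : List Q, l.flatMap (pauliPower 0) = [] := fun l => by simp [pauliPower]
      rw [if_pos rfl, f.map_zero, translation, this, mapOp_id, hfm, gatesOp_nil]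
    · have hnd : ((List.range r).map τ).Nodup := by
        rw [List.nodup_map_iff_inj_on List.nodup_range]
        exact fun i hi j hj => hτ i (List.mem_range.1 hi) j (List.mem_range.1 hj)
      have hfm : ∀ l : List Q, l.flatMap (pauliPower 1) = l.map fun q => QGate.one q pauliX := by
        intro l
        induction l with
        | nil => rfl
        | cons a l ih => simp [List.flatMap_cons, ih, pauliPower]
      rw [if_neg one_ne_zero, h₂, hfm, gatesOp_pauliX hnd]
      congr 1
      funext q
      -- After all `L` levels every residue modulo `2 ^ L` is reached.
      simp [treeIndicator, Nat.mod_lt]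
  have hTT' : T * T' = 1 := by
    rw [show T = mapOp f from h₁]; exact h₅
  have hc : P * (gatesOp e * T') = T' * (gatesOp e * P) := by
    rw [← mul_assoc, ← heP.eq, mul_assoc, ← hT'P.eq, ← mul_assoc, ← hT'e.eq, mul_assoc]
  calc (fanOut τ κ L r e).toMatrix * P
      = T * (mapOp (cnotMap (rootPairs τ κ L r)) * gatesOp e * T') * P := by
        rw [fanOut, QCircuit.toMatrix_append, QCircuit.toMatrix_append]
        simp only [QCircuit.toMatrix, hlayer, one_mul, ← hT, ← hT']
    _ = T * (mapOp (cnotMap (rootPairs τ κ L r)) * P) * (gatesOp e * T') := by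
        simp only [mul_assoc]
        rw [hT'P.eq, ← mul_assoc (gatesOp e) P, heP.eq]
        simp only [mul_assoc]
    _ = translation (f (if b = 0 then 0 else treeIndicator τ L r 0)) * (T * T') *
          (gatesOp e * P) := by
        rw [hroot]
        simp only [mul_assoc]
        rw [← mul_assoc T, htrans, hc]
        simp only [mul_assoc]
    _ = _ := by rw [hTT', mul_one, hX, mul_assoc]

end
end

/-! ### The controlled version of one layer. -/

noncomputable section

section

variable {Q : Type} [Fintype Q] [DecidableEq Q]

/-- Gate lists, one for each data gate, that realize a circuit on the states that agree with the
pattern `v` on the qubits in `K`. -/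
structure Realizes (gs : List (QGate Q)) (K : Finset Q) (v : QBasis Q) (D : QCircuit Q)
    (e : QGate Q → List (QGate Q)) : Prop where
  support : ∀ g, ∀ k ∈ e g, k.support ⊆ g.support
  eq : D.toMatrix * patternProj K v = gatesOp (gs.flatMap e) * patternProj K v

section Realizes

variable {gs : List (QGate Q)} {K : Finset Q} {v : QBasis Q}

theorem flatMap_disjoint (hK : ∀ g ∈ gs, Disjoint g.support K) {e : QGate Q → List (QGate Q)}
    (he : ∀ g, ∀ k ∈ e g, k.support ⊆ g.support) :
    ∀ k ∈ gs.flatMap e, Disjoint k.support K := by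
  intro k hk
  obtain ⟨g, hg, hkg⟩ := List.mem_flatMap.1 hk
  exact (hK g hg).mono_left (he g k hkg)

/-- Lists attached to different gates have disjoint supports and can be interleaved, so composition
happens separately within each gate. None of them touches `K`, so the projection passes through;
later gates go in front. -/
theorem Realizes.append (hgs : gs.Pairwise fun g h => Disjoint g.support h.support)
    (hK : ∀ g ∈ gs, Disjoint g.support K) {D D' : QCircuit Q} {e e' : QGate Q → List (QGate Q)}
    (h : Realizes gs K v D e) (h' : Realizes gs K v D' e') :
    Realizes gs K v (D ++ D') fun g => e' g ++ e g where
  support g k hk := by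
    rcases List.mem_append.1 hk with hk | hk
    · exact h'.support g k hk
    · exact h.support g k hk
  eq := by
    rw [← gatesOp_flatMap_mul hgs e' e h'.support h.support, QCircuit.toMatrix_append, mul_assoc,
      h.eq, (gatesOp_commute_patternProj (flatMap_disjoint hK h.support) v).eq, ← mul_assoc, h'.eq,
      mul_assoc, ← (gatesOp_commute_patternProj (flatMap_disjoint hK h.support) v).eq, mul_assoc]

theorem realizes_ofGates (hgs : gs.Pairwise fun g h => Disjoint g.support h.support)
    {e : QGate Q → List (QGate Q)} (he : ∀ g, ∀ k ∈ e g, k.support ⊆ g.support)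
    (hp : ∀ g, (e g).Pairwise fun g h => Disjoint g.support h.support) :
    Realizes gs K v [QLayer.ofGates (gs.flatMap e)] e where
  support := he
  eq := by
    simp only [QCircuit.toMatrix, one_mul, QLayer.toMatrix_eq]
    rw [QLayer.gates_ofGates (pairwise_flatMap_disjoint hgs e he hp)]

/-- Choosing one qubit `t g` per gate gives distinct fan-out targets by disjointness of the
supports. The value `q₀` only fills `getD` out of range. -/
theorem realizes_fanOut (hgs : gs.Pairwise fun g h => Disjoint g.support h.support)
    (hK : ∀ g ∈ gs, Disjoint g.support K) {κ : ℕ → Q} {L : ℕ} {t : QGate Q → Q} (q₀ : Q)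
    (ht : ∀ g, t g ∈ g.support)
    (hκ : ∀ i < gs.length, ∀ j < gs.length, κ (i / 2 ^ L) = κ (j / 2 ^ L) →
      i / 2 ^ L = j / 2 ^ L)
    (hκK : ∀ i < gs.length, κ (i / 2 ^ L) ∈ K)
    {e : QGate Q → List (QGate Q)} (he : ∀ g, ∀ k ∈ e g, k.support ⊆ g.support)
    (hp : ∀ g, (e g).Pairwise fun g h => Disjoint g.support h.support)
    (het : ∀ g, ∀ k ∈ e g, t g ∉ k.support) (b : Fin 2) :
    Realizes gs K (fun _ => b)
      (fanOut (fun i => (gs.map t).getD i q₀) κ L gs.length (gs.flatMap e))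
      fun g => pauliPower b (t g) ++ e g where
  support g k hk := by
    rcases List.mem_append.1 hk with hk | hk
    · unfold pauliPower at hk
      split_ifs at hk
      · simp at hk
      · rw [List.mem_singleton] at hk
        subst hk
        simpa [QGate.support] using ht g
    · exact he g k hk
  eq := by
    have hpp : ∀ g, ∀ k ∈ pauliPower b (t g), k.support ⊆ g.support := by
      intro g k hk
      unfold pauliPower at hk
      split_ifs at hk
      · simp at hk
      · rw [List.mem_singleton] at hk
        subst hk
        simpa [QGate.support] using ht g
    have hget : ∀ i (hi : i < gs.length), (gs.map t).getD i q₀ = t gs[i] := by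
      intro i hi
      simp [List.getD_eq_getElem?_getD, hi]
    have hdis : ∀ i (hi : i < gs.length) j (hj : j < gs.length), i ≠ j →
        Disjoint gs[i].support gs[j].support := by
      intro i hi j hj hij
      rw [List.pairwise_iff_getElem] at hgs
      rcases lt_or_gt_of_ne hij with h | h
      · exact hgs i j hi hj h
      · exact (hgs j i hj hi h).symm
    have hmap : (List.range gs.length).map (fun i => (gs.map t).getD i q₀) = gs.map t := by
      refine List.ext_getElem (by simp) fun i hi _ => ?_
      simp only [List.length_map, List.length_range] at hi
      simp [hi]
    rw [fanOut_mul_patternProj _ _ hκ hκK (pairwise_flatMap_disjoint hgs e he hp) _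
      (flatMap_disjoint hK he), hmap, List.flatMap_map, gatesOp_flatMap_mul hgs _ _ hpp he]
    · intro i hi j hj hij
      rw [hget i hi, hget j hj] at hij
      by_contra hne
      exact Finset.disjoint_left.1 (hdis i hi j hj hne) (ht _) (hij ▸ ht _)
    · intro i hi
      rw [hget i hi]
      exact Finset.disjoint_left.1 (hK _ (List.getElem_mem hi)) (ht _)
    · intro k hk i hi
      rw [hget i hi]
      obtain ⟨g, hg, hkg⟩ := List.mem_flatMap.1 hk
      obtain ⟨j, hj, rfl⟩ := List.getElem_of_mem hg
      by_cases hij : i = j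
      · subst hij; exact het _ k hkg
      · exact fun h => Finset.disjoint_left.1 (hdis i hi j hj hij) (ht _) (he _ k hkg h)

end Realizes

/-- The first factor of an `ABC` decomposition. -/
def abcA (U : Matrix.unitaryGroup (Fin 2) ℂ) : Matrix.unitaryGroup (Fin 2) ℂ :=
  (exists_abc U).choose

/-- The second factor of an `ABC` decomposition. -/
def abcB (U : Matrix.unitaryGroup (Fin 2) ℂ) : Matrix.unitaryGroup (Fin 2) ℂ :=
  (exists_abc U).choose_spec.choose

/-- The third factor of an `ABC` decomposition. -/
def abcC (U : Matrix.unitaryGroup (Fin 2) ℂ) : Matrix.unitaryGroup (Fin 2) ℂ :=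
  (exists_abc U).choose_spec.choose_spec.choose

/-- The phase of an `ABC` decomposition. -/
def abcPhase (U : Matrix.unitaryGroup (Fin 2) ℂ) : Circle :=
  (exists_abc U).choose_spec.choose_spec.choose_spec.choose

theorem abc_off (U : Matrix.unitaryGroup (Fin 2) ℂ) : (abcA U).1 * (abcB U).1 * (abcC U).1 = 1 :=
  (exists_abc U).choose_spec.choose_spec.choose_spec.choose_spec.1

theorem abc_on (U : Matrix.unitaryGroup (Fin 2) ℂ) :
    (abcA U).1 * pauliX.1 * (abcB U).1 * pauliX.1 * (abcC U).1 =
      (((abcPhase U)⁻¹ : Circle) : ℂ) • U.1 :=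
  (exists_abc U).choose_spec.choose_spec.choose_spec.choose_spec.2

namespace QGate

/-- The first qubit of a gate. -/
def wireA : QGate Q → Q
  | one q _ => q
  | two p _ _ _ => p

/-- The last qubit of a gate. -/
def wireB : QGate Q → Q
  | one q _ => q
  | two _ q _ _ => q

/-- The phase that is acquired by the control in the controlled version of a gate. -/
def ctrlPhase : QGate Q → Circle
  | one _ U => abcPhase U
  | two _ _ _ _ => eighthRoot

/-- The local gates before the first fan-out of a controlled gate. -/
def prepare : QGate Q → List (QGate Q)
  | one q U => [one q (abcC U)]
  | two p q _ _ => [one p (phaseUnitary eighthRoot),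
      one q (phaseUnitary eighthRoot * hadamardUnitary)]

/-- The reversed CNOT gate. -/
def reversed : QGate Q → List (QGate Q)
  | one _ _ => []
  | two p q _ _ => [cnotGate q p]

/-- The phase gate on the first qubit of a two-qubit gate. -/
def phaseA (z : Circle) : QGate Q → List (QGate Q)
  | one _ _ => []
  | two p _ _ _ => [one p (phaseUnitary z)]

/-- The phase gate on the second qubit of a two-qubit gate. -/
def phaseB (z : Circle) : QGate Q → List (QGate Q)
  | one _ _ => []
  | two _ q _ _ => [one q (phaseUnitary z)]

/-- The local gates between the last two fan-outs of a controlled gate. -/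
def intermediate : QGate Q → List (QGate Q)
  | one q U => [one q (abcB U)]
  | two p _ _ _ => [one p (phaseUnitary eighthRoot⁻¹)]

/-- The local gates after the last fan-out of a controlled gate. -/
def finish : QGate Q → List (QGate Q)
  | one q U => [one q (abcA U)]
  | two _ q _ _ => [one q hadamardUnitary]

theorem toMatrix_one_eq_pair_first {p q : Q} (h : p ≠ q) (U : Matrix.unitaryGroup (Fin 2) ℂ) :
    (one p U).toMatrix = (QLens.pair p q h).op (QLens.first.op U.1) := by
  rw [← QLens.op_comp, QLens.pair_comp_first, toMatrix_one]

theorem toMatrix_one_eq_pair_second {p q : Q} (h : p ≠ q) (U : Matrix.unitaryGroup (Fin 2) ℂ) :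
    (one q U).toMatrix = (QLens.pair p q h).op (QLens.second.op U.1) := by
  rw [← QLens.op_comp, QLens.pair_comp_second, toMatrix_one]

theorem toMatrix_cnotGate_eq_pair {p q : Q} (h : p ≠ q) :
    (cnotGate p q).toMatrix = (QLens.pair p q h).op cnotMatrix := by
  rw [cnotGate, dif_pos h, toMatrix_two]; rfl

theorem toMatrix_cnotGate_eq_pair_exchange {p q : Q} (h : p ≠ q) :
    (cnotGate q p).toMatrix = (QLens.pair p q h).op (QLens.exchange.op cnotMatrix) := by
  rw [← QLens.op_comp, QLens.pair_comp_exchange, toMatrix_cnotGate_eq_pair]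

theorem pauliX_mul_self : pauliX.1 * pauliX.1 = 1 := by
  ext i j
  fin_cases i <;> fin_cases j <;> simp [pauliX]

/-- All local gates of the controlled version of a gate, for a given value of the control. -/
def template (b : Fin 2) (g : QGate Q) : List (QGate Q) :=
  finish g ++ ((pauliPower b g.wireA ++ []) ++ (intermediate g ++ (reversed g ++
    ((pauliPower b g.wireB ++ phaseA eighthRoot g) ++
      ((pauliPower b g.wireA ++ phaseB eighthRoot⁻¹ g) ++
        ((pauliPower b g.wireB ++ phaseA eighthRoot⁻¹ g) ++ (reversed g ++ prepare g)))))))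

theorem gatesOp_template_zero (g : QGate Q) : gatesOp (template 0 g) = 1 := by
  cases g with
  | one q U =>
    simp only [template, finish, intermediate, reversed, phaseA, phaseB, prepare, pauliPower,
      if_true, List.nil_append, List.cons_append, gatesOp_cons, gatesOp_nil, mul_one,
      toMatrix_one, ← QLens.op_mul]
    rw [← mul_assoc, abc_off, QLens.op_one]
  | two p q h U =>
    simp only [template, finish, intermediate, reversed, phaseA, phaseB, prepare, pauliPower,
      if_true, List.nil_append, List.cons_append, gatesOp_cons, gatesOp_nil, mul_one,
      toMatrix_one_eq_pair_first h, toMatrix_one_eq_pair_second h,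
      toMatrix_cnotGate_eq_pair_exchange h, ← QLens.op_mul]
    rw [show (phaseUnitary eighthRoot * hadamardUnitary).1 =
      (phaseUnitary eighthRoot).1 * hadamardUnitary.1 from rfl, QLens.op_mul QLens.second]
    have := cnot_template_off
    simp only [mul_assoc] at this
    rw [this, QLens.op_one]

/-- For a CNOT the parities are met in the order `p`, `q`, `p⊕q`, `c⊕q`, `c⊕p⊕q`, `c⊕p`. The missing
phase on the control bit `c` is the scalar on the right-hand side. -/
theorem gatesOp_template_one {g : QGate Q} (hg : g.IsCnotOrSingle) :
    gatesOp (template 1 g) = (((ctrlPhase g)⁻¹ : Circle) : ℂ) • g.toMatrix := by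
  cases g with
  | one q U =>
    simp only [template, finish, intermediate, reversed, phaseA, phaseB, prepare, pauliPower,
      one_ne_zero, if_false, List.nil_append, List.cons_append, gatesOp_cons, gatesOp_nil, mul_one,
      List.append_nil, wireA, wireB, toMatrix_one, ← QLens.op_mul, ctrlPhase]
    have := abc_on U
    simp only [mul_assoc] at this
    -- A one-qubit gate shares the four fan-outs of the CNOT template, so X occurs three times
    -- between `C` and `B`; two of them cancel.
    rw [← mul_assoc pauliX.1 pauliX.1 (abcC U).1, pauliX_mul_self, one_mul, this, QLens.op_smul]
  | two p q h U =>
    simp only [template, finish, intermediate, reversed, phaseA, phaseB, prepare, pauliPower,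
      one_ne_zero, if_false, List.nil_append, List.cons_append, gatesOp_cons, gatesOp_nil, mul_one,
      List.append_nil, wireA, wireB,
      toMatrix_one_eq_pair_first h, toMatrix_one_eq_pair_second h,
      toMatrix_cnotGate_eq_pair_exchange h, ← QLens.op_mul, ctrlPhase]
    rw [show (phaseUnitary eighthRoot * hadamardUnitary).1 =
      (phaseUnitary eighthRoot).1 * hadamardUnitary.1 from rfl, QLens.op_mul QLens.second]
    have := cnot_template_on
    simp only [mul_assoc] at this
    rw [this, QLens.op_smul, toMatrix_two, show U.1 = cnotMatrix from hg, Circle.coe_inv]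

end QGate

open QGate in
/-- The controlled version of a layer with `s` copies of the control, each of which controls
`2 ^ L` gates. -/
theorem exists_controlled_layer {gs : List (QGate Q)} {K : Finset Q}
    (hgs : gs.Pairwise fun g h => Disjoint g.support h.support)
    (hK : ∀ g ∈ gs, Disjoint g.support K) (hcs : ∀ g ∈ gs, g.IsCnotOrSingle)
    {κ : ℕ → Q} {L : ℕ} {q₀ : Q} (hq₀ : q₀ ∈ K)
    (hκ : ∀ i < gs.length, ∀ j < gs.length, κ (i / 2 ^ L) = κ (j / 2 ^ L) →
      i / 2 ^ L = j / 2 ^ L)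
    (hκK : ∀ i < gs.length, κ (i / 2 ^ L) ∈ K) :
    ∃ D : QCircuit Q, D.UsesCnotAndSingle ∧ D.depth = 8 * L + 9 ∧
      ∀ b : Fin 2, D.toMatrix * patternProj K (fun _ => b) =
        (if b = 0 then 1 else gatesOp gs) * patternProj K (fun _ => b) := by
  have sP : ∀ g : QGate Q, ∀ k ∈ prepare g, k.support ⊆ g.support := by
    rintro (_ | _) <;> simp [prepare, support]
  have sR : ∀ g : QGate Q, ∀ k ∈ reversed g, k.support ⊆ g.support := by
    rintro (⟨q, U⟩ | ⟨p, q, h, U⟩) k hk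
    · simp [reversed] at hk
    · rw [reversed, List.mem_singleton] at hk
      subst hk
      rw [support, Finset.pair_comm]
      exact support_cnotGate_subset _ _
  have sA : ∀ z, ∀ g : QGate Q, ∀ k ∈ phaseA z g, k.support ⊆ g.support := by
    rintro z (_ | _) <;> simp [phaseA, support]
  have sB : ∀ z, ∀ g : QGate Q, ∀ k ∈ phaseB z g, k.support ⊆ g.support := by
    rintro z (_ | _) <;> simp [phaseB, support]
  have sI : ∀ g : QGate Q, ∀ k ∈ intermediate g, k.support ⊆ g.support := by
    rintro (_ | _) <;> simp [intermediate, support]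
  have sF : ∀ g : QGate Q, ∀ k ∈ finish g, k.support ⊆ g.support := by
    rintro (_ | _) <;> simp [finish, support]
  have pP : ∀ g : QGate Q, (prepare g).Pairwise fun g h => Disjoint g.support h.support := by
    rintro (⟨q, U⟩ | ⟨p, q, h, U⟩) <;> simp [prepare, support]
    exact h
  have pR : ∀ g : QGate Q, (reversed g).Pairwise fun g h => Disjoint g.support h.support := by
    rintro (_ | _) <;> simp [reversed]
  have pA : ∀ z, ∀ g : QGate Q, (phaseA z g).Pairwise fun g h => Disjoint g.support h.support := by
    rintro z (_ | _) <;> simp [phaseA]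
  have pB : ∀ z, ∀ g : QGate Q, (phaseB z g).Pairwise fun g h => Disjoint g.support h.support := by
    rintro z (_ | _) <;> simp [phaseB]
  have pI : ∀ g : QGate Q, (intermediate g).Pairwise
      fun g h => Disjoint g.support h.support := by
    rintro (_ | _) <;> simp [intermediate]
  have pF : ∀ g : QGate Q, (finish g).Pairwise fun g h => Disjoint g.support h.support := by
    rintro (_ | _) <;> simp [finish]
  have wA : ∀ g : QGate Q, g.wireA ∈ g.support := by
    rintro (_ | _) <;> simp [wireA, support]
  have wB : ∀ g : QGate Q, g.wireB ∈ g.support := by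
    rintro (_ | _) <;> simp [wireB, support]
  have wA' : ∀ z, ∀ g : QGate Q, ∀ k ∈ phaseB z g, g.wireA ∉ k.support := by
    rintro z (⟨q, U⟩ | ⟨p, q, h, U⟩) <;> simp [phaseB, wireA, support]
    exact h
  have wB' : ∀ z, ∀ g : QGate Q, ∀ k ∈ phaseA z g, g.wireB ∉ k.support := by
    rintro z (⟨q, U⟩ | ⟨p, q, h, U⟩) <;> simp [phaseA, wireB, support]
    exact fun h' => h h'.symm
  -- One diagonal gate on the single control copy `q₀` supplies the phases of all gates. It shares
  -- the final layer with the `finish` gates, since `q₀` lies outside their supports.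
  set z : Circle := (gs.map ctrlPhase).prod with hz
  set last : QLayer Q := QLayer.ofGates (gs.flatMap finish ++ [one q₀ (phaseUnitary z)])
    with hlast
  set τA : ℕ → Q := fun i => (gs.map wireA).getD i q₀
  set τB : ℕ → Q := fun i => (gs.map wireB).getD i q₀
  have hcnil : ∀ g : QGate Q, ∀ k ∈ ([] : List (QGate Q)), k.IsCnotOrSingle := by simp
  have hc : ∀ {e : QGate Q → List (QGate Q)}, (∀ g, ∀ k ∈ e g, k.IsCnotOrSingle) →
      ∀ k ∈ gs.flatMap e, k.IsCnotOrSingle := by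
    intro e he k hk
    obtain ⟨g, _, hk⟩ := List.mem_flatMap.1 hk
    exact he g k hk
  have hc1 : ∀ {l : List (QGate Q)}, (∀ k ∈ l, k.IsCnotOrSingle) →
      QCircuit.UsesCnotAndSingle [QLayer.ofGates l] := by
    intro l hl M hM g hg
    rw [List.mem_singleton] at hM
    subst hM
    exact hl g (QLayer.mem_of_mem_ofGates hg)
  have cP : ∀ g : QGate Q, ∀ k ∈ prepare g, k.IsCnotOrSingle := by
    rintro (_ | _) <;> simp [prepare, IsCnotOrSingle]
  have cR : ∀ g : QGate Q, ∀ k ∈ reversed g, k.IsCnotOrSingle := by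
    rintro (_ | _) <;> simp [reversed, cnotGate_isCnotOrSingle]
  have cA : ∀ z, ∀ g : QGate Q, ∀ k ∈ phaseA z g, k.IsCnotOrSingle := by
    rintro z (_ | _) <;> simp [phaseA, IsCnotOrSingle]
  have cB : ∀ z, ∀ g : QGate Q, ∀ k ∈ phaseB z g, k.IsCnotOrSingle := by
    rintro z (_ | _) <;> simp [phaseB, IsCnotOrSingle]
  have cI : ∀ g : QGate Q, ∀ k ∈ intermediate g, k.IsCnotOrSingle := by
    rintro (_ | _) <;> simp [intermediate, IsCnotOrSingle]
  have cF : ∀ g : QGate Q, ∀ k ∈ finish g, k.IsCnotOrSingle := by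
    rintro (_ | _) <;> simp [finish, IsCnotOrSingle]
  -- The fan-outs hit the second, first, second and first qubit, as in `template`. With `last` there
  -- are five local layers, and `4 * (2 * L + 1) + 5 = 8 * L + 9`.
  set D : QCircuit Q := [QLayer.ofGates (gs.flatMap prepare)] ++
    [QLayer.ofGates (gs.flatMap reversed)] ++
    fanOut τB κ L gs.length (gs.flatMap (phaseA eighthRoot⁻¹)) ++
    fanOut τA κ L gs.length (gs.flatMap (phaseB eighthRoot⁻¹)) ++
    fanOut τB κ L gs.length (gs.flatMap (phaseA eighthRoot)) ++
    [QLayer.ofGates (gs.flatMap reversed)] ++ [QLayer.ofGates (gs.flatMap intermediate)] ++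
    fanOut τA κ L gs.length (gs.flatMap fun _ => []) with hD
  refine ⟨D ++ [last], ?_, ?_, fun b => ?_⟩
  · refine QCircuit.usesCnotAndSingle_append ?_ (hc1 ?_)
    · have hf : ∀ t e, (∀ g, ∀ k ∈ e g, k.IsCnotOrSingle) →
          (fanOut t κ L gs.length (gs.flatMap e)).UsesCnotAndSingle :=
        fun t e he => fanOut_usesCnotAndSingle _ _ _ _ (hc he)
      have happ := @QCircuit.usesCnotAndSingle_append Q _ _
      exact happ (happ (happ (happ (happ (happ (happ (hc1 (hc cP)) (hc1 (hc cR))) (hf _ _ (cA _)))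
        (hf _ _ (cB _))) (hf _ _ (cA _))) (hc1 (hc cR))) (hc1 (hc cI))) (hf _ _ hcnil)
    · intro k hk
      rcases List.mem_append.1 hk with hk | hk
      · exact hc cF k hk
      · rw [List.mem_singleton] at hk
        subst hk
        trivial
  · simp only [hD, QCircuit.depth_append, depth_fanOut]
    simp only [QCircuit.depth, List.length_singleton]
    ring
  · set P := patternProj K (fun _ => b) with hP
    have hreal := ((((((((realizes_ofGates hgs sP pP).append hgs hK
      (realizes_ofGates hgs sR pR)).append hgs hK
      (realizes_fanOut hgs hK q₀ wB hκ hκK (sA eighthRoot⁻¹) (pA _) (wB' _) b)).append hgs hK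
      (realizes_fanOut hgs hK q₀ wA hκ hκK (sB eighthRoot⁻¹) (pB _) (wA' _) b)).append hgs hK
      (realizes_fanOut hgs hK q₀ wB hκ hκK (sA eighthRoot) (pA _) (wB' _) b)).append hgs hK
      (realizes_ofGates hgs sR pR)).append hgs hK
      (realizes_ofGates hgs sI pI)).append hgs hK
      (realizes_fanOut (e := fun _ => []) hgs hK q₀ wA hκ hκK (by simp) (by simp) (by simp) b))
    change Realizes gs K _ D _ at hreal
    have hlastP : last.toMatrix * P =
        (if b = 0 then 1 else (z : ℂ)) • (gatesOp (gs.flatMap finish) * P) := by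
      rw [QLayer.toMatrix_eq, hlast, QLayer.gates_ofGates, gatesOp_append, mul_assoc, gatesOp_cons,
        gatesOp_nil, mul_one, hP, phase_mul_patternProj (fun _ => b) hq₀, Matrix.mul_smul]
      rw [List.pairwise_append]
      refine ⟨pairwise_flatMap_disjoint hgs _ sF pF, by simp, fun g hg k hk => ?_⟩
      rw [List.mem_singleton] at hk
      subst hk
      rw [support, Finset.disjoint_singleton_right]
      exact Finset.disjoint_right.1 (flatMap_disjoint hK sF g hg) hq₀
    have hcomm := gatesOp_commute_patternProj (flatMap_disjoint hK hreal.support) (fun _ => b)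
    rw [QCircuit.toMatrix_append, mul_assoc, hreal.eq, hcomm.eq, ← mul_assoc]
    simp only [QCircuit.toMatrix, one_mul]
    rw [hlastP, Matrix.smul_mul, mul_assoc, ← hcomm.eq, ← mul_assoc,
      gatesOp_flatMap_mul hgs _ _ sF hreal.support, ← Matrix.smul_mul]
    congr 1
    have hfold : ∀ l : List (QGate Q), (∀ g ∈ l, g.IsCnotOrSingle) →
        (if b = 0 then 1 else ((l.map ctrlPhase).prod : ℂ)) • gatesOp (l.flatMap (template b)) =
          if b = 0 then 1 else gatesOp l := by
      intro l hl
      induction l with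
      | nil => simp
      | cons g l ih =>
        have ih := ih fun g hg => hl g (List.mem_cons_of_mem _ hg)
        have hb : b = 0 ∨ b = 1 := by fin_cases b <;> simp
        rcases hb with rfl | rfl
        · simp only [if_true, one_smul] at ih ⊢
          rw [List.flatMap_cons, gatesOp_append, ih, gatesOp_template_zero, one_mul]
        · simp only [one_ne_zero, if_false] at ih ⊢
          have hne : (g.ctrlPhase : ℂ) ≠ 0 := Circle.coe_ne_zero _
          rw [List.flatMap_cons, gatesOp_append, gatesOp_template_one (hl g List.mem_cons_self),
            List.map_cons, List.prod_cons, Circle.coe_mul, mul_comm (g.ctrlPhase : ℂ), mul_smul,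
            Matrix.smul_mul, smul_smul (g.ctrlPhase : ℂ), Circle.coe_inv, mul_inv_cancel₀ hne,
            one_smul, ← Matrix.mul_smul, ih, gatesOp_cons]
    exact hfold gs hcs

end
end

/-! ### Embedded registers and controlled circuits. -/

noncomputable section

namespace QLens

variable {P Q : Type} {δ : P → Q}

theorem extend_update [DecidableEq P] [DecidableEq Q] (hδ : Function.Injective δ) (u : QBasis P) (x : QBasis Q) (p : P)
    (b : Fin 2) : Function.extend δ (Function.update u p b) x =
      Function.update (Function.extend δ u x) (δ p) b := by
  funext r
  by_cases hr : ∃ i, δ i = r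
  · obtain ⟨i, rfl⟩ := hr
    rw [hδ.extend_apply]
    by_cases hi : i = p
    · subst hi; simp
    · rw [Function.update_of_ne hi, Function.update_of_ne (fun h => hi (hδ h)), hδ.extend_apply]
  · rw [Function.extend_apply' _ _ _ hr, Function.update_of_ne (fun h => hr ⟨p, h.symm⟩),
      Function.extend_apply' _ _ _ hr]

theorem extend_comp_self (hδ : Function.Injective δ) (x : QBasis Q) : Function.extend δ (x ∘ δ) x = x :=
  (subregister δ hδ).set_get x

theorem subregister_comp_qubit [DecidableEq P] [DecidableEq Q] (hδ : Function.Injective δ)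
    (p : P) :
    (subregister δ hδ).comp (qubit p) = qubit (δ p) := by
  ext1
  · rfl
  · simp only [comp, subregister, qubit, extend_update hδ, extend_comp_self hδ]

theorem subregister_comp_pair [DecidableEq P] [DecidableEq Q] (hδ : Function.Injective δ)
    (p q : P) (h : p ≠ q) :
    (subregister δ hδ).comp (pair p q h) = pair (δ p) (δ q) (hδ.ne h) := by
  ext1
  · rfl
  · simp only [comp, subregister, pair, extend_update hδ, extend_comp_self hδ]

theorem extend_update_of_notMem [DecidableEq Q] {q : Q} (hq : q ∉ Set.range δ) (u : QBasis P)
    (x : QBasis Q) (b : Fin 2) (hδ : Function.Injective δ) :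
    Function.update (Function.extend δ u x) q b = Function.extend δ u (Function.update x q b) := by
  funext r
  by_cases hr : ∃ i, δ i = r
  · obtain ⟨i, rfl⟩ := hr
    rw [Function.update_of_ne (fun h => hq ⟨i, h⟩), hδ.extend_apply, hδ.extend_apply]
  · rw [Function.extend_apply' _ _ _ hr]
    by_cases hrq : r = q
    · subst hrq; simp
    · rw [Function.update_of_ne hrq, Function.update_of_ne hrq, Function.extend_apply' _ _ _ hr]

end QLens

namespace QGate

variable {P Q : Type} [Fintype P] [DecidableEq P] [Fintype Q] [DecidableEq Q] {δ : P → Q}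

/-- Transport of a gate along an embedding of registers. -/
def map (δ : P → Q) (hδ : Function.Injective δ) : QGate P → QGate Q
  | one q U => one (δ q) U
  | two p q h U => two (δ p) (δ q) (hδ.ne h) U

theorem toMatrix_map (hδ : Function.Injective δ) (g : QGate P) :
    (g.map δ hδ).toMatrix = (QLens.subregister δ hδ).op g.toMatrix := by
  cases g with
  | one q U =>
    rw [toMatrix_one, ← QLens.op_comp, QLens.subregister_comp_qubit, map, toMatrix_one]
  | two p q h U =>
    rw [toMatrix_two, ← QLens.op_comp, QLens.subregister_comp_pair, map, toMatrix_two]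

theorem support_map (hδ : Function.Injective δ) (g : QGate P) :
    (g.map δ hδ).support = g.support.image δ := by
  cases g <;> simp [map, support, Finset.image_insert]

theorem isCnotOrSingle_map (hδ : Function.Injective δ) {g : QGate P} (hg : g.IsCnotOrSingle) :
    (g.map δ hδ).IsCnotOrSingle := by
  cases g
  · trivial
  · exact hg

theorem gatesOp_map (hδ : Function.Injective δ) (l : List (QGate P)) :
    gatesOp (l.map (map δ hδ)) = (QLens.subregister δ hδ).op (gatesOp l) := by
  induction l with
  | nil => simp [QLens.op_one]
  | cons g l ih => rw [List.map_cons, gatesOp_cons, ih, toMatrix_map, gatesOp_cons, QLens.op_mul]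

theorem commute_subregister (hδ : Function.Injective δ) {g : QGate Q}
    (hg : ∀ p, δ p ∉ g.support) (M : QOp P) :
    Commute g.toMatrix ((QLens.subregister δ hδ).op M) := by
  cases g with
  | one q U =>
    have hq : q ∉ Set.range δ := by
      rintro ⟨p, rfl⟩
      exact hg p (by simp [support])
    rw [toMatrix_one]
    exact QLens.commute_op _ _ (fun b u x => QLens.extend_update_of_notMem hq u x b hδ) _ _
  | two p q h U =>
    have hp : p ∉ Set.range δ := by
      rintro ⟨i, rfl⟩
      exact hg i (by simp [support])
    have hq : q ∉ Set.range δ := by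
      rintro ⟨i, rfl⟩
      exact hg i (by simp [support])
    rw [toMatrix_two]
    refine QLens.commute_op _ _ (fun b u x => ?_) _ _
    simp only [QLens.pair, QLens.subregister]
    rw [QLens.extend_update_of_notMem hp u x _ hδ, QLens.extend_update_of_notMem hq u _ _ hδ]

end QGate

section

variable {P Q : Type} [Fintype P] [DecidableEq P] [Fintype Q] [DecidableEq Q] {δ : P → Q}

theorem subregister_commute_patternProj (hδ : Function.Injective δ) {K : Finset Q}
    (hK : ∀ p, δ p ∉ K) (M : QOp P) (v : QBasis Q) :
    Commute ((QLens.subregister δ hδ).op M) (patternProj K v) := by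
  ext x y
  rw [patternProj, Matrix.mul_diagonal, Matrix.diagonal_mul]
  by_cases hxy : (QLens.subregister δ hδ).op M x y = 0
  · simp [hxy]
  · have hxy' : Function.extend δ (y ∘ δ) x = y := by
      by_contra h
      exact hxy (if_neg h)
    have : (∀ q ∈ K, x q = v q) ↔ ∀ q ∈ K, y q = v q := forall₂_congr fun q hq => by
      rw [← hxy', Function.extend_apply' _ _ _ (fun ⟨p, hp⟩ => hK p (hp ▸ hq))]
    simp only [this, mul_comm]

/-- Disjoint gates have distinct first qubits. This bounds the number of blocks by the number of
control copies. -/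
theorem length_le_card {gs : List (QGate Q)}
    (hgs : gs.Pairwise fun g h => Disjoint g.support h.support) :
    gs.length ≤ Fintype.card Q := by
  have hw : ∀ g : QGate Q, g.wireA ∈ g.support := by
    rintro (_ | _) <;> simp [QGate.wireA, QGate.support]
  have : (gs.map QGate.wireA).Nodup := by
    rw [List.Nodup, List.pairwise_map]
    exact hgs.imp fun {g h} hd (heq : g.wireA = h.wireA) =>
      Finset.disjoint_left.1 hd (hw g) (heq ▸ hw h)
  simpa using this.length_le_card

/-- The controlled version of a circuit, given copies of the control. -/
theorem exists_controlled_of_copies (hδ : Function.Injective δ) {K : Finset Q}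
    (hK : ∀ p, δ p ∉ K) {κ : ℕ → Q} {s L : ℕ} (hs : 0 < s) (hκK : ∀ i < s, κ i ∈ K)
    (hκ : ∀ i < s, ∀ j < s, κ i = κ j → i = j) (hL : Fintype.card P ≤ s * 2 ^ L)
    (C : QCircuit P) (hC : C.UsesCnotAndSingle) :
    ∃ D : QCircuit Q, D.UsesCnotAndSingle ∧ D.depth = C.depth * (8 * L + 9) ∧
      ∀ b : Fin 2, D.toMatrix * patternProj K (fun _ => b) =
        (if b = 0 then 1 else (QLens.subregister δ hδ).op C.toMatrix) *
          patternProj K (fun _ => b) := by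
  induction C with
  | nil =>
    refine ⟨[], by simp [QCircuit.UsesCnotAndSingle], by simp [QCircuit.depth], fun b => ?_⟩
    simp [QCircuit.toMatrix, QLens.op_one]
  | cons l C ih =>
    obtain ⟨D, hD₁, hD₂, hD₃⟩ := ih fun l' hl' => hC l' (List.mem_cons_of_mem _ hl')
    have hlen : ∀ i < (l.gates.map (QGate.map δ hδ)).length, i / 2 ^ L < s := by
      intro i hi
      rw [List.length_map] at hi
      rw [Nat.div_lt_iff_lt_mul (by positivity)]
      have := length_le_card l.disjoint
      omega
    obtain ⟨E, hE₁, hE₂, hE₃⟩ := exists_controlled_layer (gs := l.gates.map (QGate.map δ hδ))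
      (K := K) (κ := κ) (L := L) (q₀ := κ 0)
      (by
        rw [List.pairwise_map]
        refine l.disjoint.imp fun {g h} hd => ?_
        rw [QGate.support_map, QGate.support_map, Finset.disjoint_image hδ]
        exact hd)
      (by
        intro g hg
        obtain ⟨g, _, rfl⟩ := List.mem_map.1 hg
        rw [QGate.support_map, Finset.disjoint_left]
        intro q hq
        obtain ⟨p, _, rfl⟩ := Finset.mem_image.1 hq
        exact hK p)
      (by
        intro g hg
        obtain ⟨g, hg', rfl⟩ := List.mem_map.1 hg
        exact QGate.isCnotOrSingle_map hδ (hC l List.mem_cons_self g hg'))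
      (hκK 0 hs)
      (fun i hi j hj => hκ _ (hlen i hi) _ (hlen j hj))
      (fun i hi => hκK _ (hlen i hi))
    refine ⟨E ++ D, QCircuit.usesCnotAndSingle_append hE₁ hD₁, ?_, fun b => ?_⟩
    · rw [QCircuit.depth_append, hE₂, hD₂, QCircuit.depth, QCircuit.depth, List.length_cons]
      ring
    · rw [QCircuit.toMatrix_append, mul_assoc, hE₃]
      have hb : b = 0 ∨ b = 1 := by fin_cases b <;> simp
      rcases hb with rfl | rfl
      · simpa using hD₃ 0
      · have h := hD₃ 1
        simp only [one_ne_zero, if_false] at h ⊢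
        have hcomm := subregister_commute_patternProj hδ hK (gatesOp l.gates) fun _ => 1
        rw [QGate.gatesOp_map, hcomm.eq, ← mul_assoc, h, mul_assoc, ← hcomm.eq, ← mul_assoc,
          ← QLens.op_mul]
        rfl

/-- The controlled version of a circuit, with the copies of the control made by a fan-out tree
from a state in which only `κ 0` may be nonzero. -/
theorem exists_controlled_of_zeros (hδ : Function.Injective δ) {K : Finset Q}
    (hK : ∀ p, δ p ∉ K) {κ : ℕ → Q} {s L c : ℕ} (hs : 0 < s) (hκK : ∀ q, q ∈ K ↔ ∃ i < s, κ i = q)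
    (hκ : ∀ i < s, ∀ j < s, κ i = κ j → i = j) (hL : Fintype.card P ≤ s * 2 ^ L)
    (hc : s ≤ 2 ^ c) (C : QCircuit P) (hC : C.UsesCnotAndSingle) :
    ∃ D : QCircuit Q, D.UsesCnotAndSingle ∧ D.depth = 2 * c + C.depth * (8 * L + 9) ∧
      ∀ b : Fin 2, D.toMatrix * patternProj K (Pi.single (κ 0) b) =
        (if b = 0 then 1 else (QLens.subregister δ hδ).op C.toMatrix) *
          patternProj K (Pi.single (κ 0) b) := by
  obtain ⟨B, hB₁, hB₂, hB₃⟩ := exists_controlled_of_copies hδ hK hs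
    (fun i hi => (hκK _).2 ⟨i, hi, rfl⟩) hκ hL C hC
  -- Since `s ≤ 2 ^ c`, all copies form a single block with root `κ 0`.
  obtain ⟨f, h₁, h₂, h₃, h₄, -⟩ := treeCircuit_spec (L := c) hκ le_rfl
  change QCircuit.toMatrix (treeCircuit κ c s) = _ at h₁
  change QCircuit.toMatrix (List.reverse (treeCircuit κ c s)) * _ = _ at h₄
  refine ⟨treeCircuit κ c s ++ B ++ (treeCircuit κ c s).reverse,
    QCircuit.usesCnotAndSingle_append (QCircuit.usesCnotAndSingle_append
      treeCircuit_usesCnotAndSingle hB₁)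
      (QCircuit.usesCnotAndSingle_reverse treeCircuit_usesCnotAndSingle), ?_, fun b => ?_⟩
  · rw [QCircuit.depth_append, QCircuit.depth_append, hB₂]
    simp only [QCircuit.depth, treeCircuit, List.length_reverse, List.length_map,
      List.length_range]
    ring
  · set M : QOp Q := if b = 0 then 1 else (QLens.subregister δ hδ).op C.toMatrix with hM
    set T := treeCircuit κ c s with hT
    have hf : ∀ y : QBasis Q, (∀ q ∈ K, y q = (Pi.single (κ 0) b : QBasis Q) q) →
        ∀ q ∈ K, f y q = b := by
      intro y hy q hq
      have hb : b = 0 ∨ b = 1 := by fin_cases b <;> simp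
      rcases hb with rfl | rfl
      · rw [h₃ y fun i hi => by rw [hy _ ((hκK _).2 ⟨i, hi, rfl⟩)]; simp, hy q hq]
        simp
      · have hind : ∀ q ∈ K, treeIndicator κ c s 0 q = (Pi.single (κ 0) 1 : QBasis Q) q := by
          intro q hq
          obtain ⟨i, hi, rfl⟩ := (hκK q).1 hq
          by_cases h0 : i = 0
          · subst h0
            rw [Pi.single_eq_same, treeIndicator, if_pos ⟨0, hs, by simp, rfl⟩]
          · rw [Pi.single_eq_of_ne (fun h => h0 (hκ _ hi _ hs h)), treeIndicator, if_neg]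
            rintro ⟨j, hj, hj', hji⟩
            rw [Nat.mod_eq_of_lt (by omega), pow_zero, Nat.lt_one_iff] at hj'
            exact h0 (by rw [← hκ _ hj _ hi hji, hj'])
        -- Modulo 2 the state splits into the root indicator, which spreads to all copies, and a
        -- part vanishing on `K`, which `f` fixes.
        have hy' : y = treeIndicator κ c s 0 + (y + treeIndicator κ c s 0) := by
          funext r
          rw [Pi.add_apply, Pi.add_apply, add_comm (y r), ← add_assoc, Fin.two_add_self, zero_add]
        have hzero : ∀ q ∈ K, (y + treeIndicator κ c s 0) q = 0 := by
          intro q hq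
          rw [Pi.add_apply, hy q hq, hind q hq, Fin.two_add_self]
        rw [hy', f.map_add, h₂, h₃ _ fun i hi => hzero _ ((hκK _).2 ⟨i, hi, rfl⟩), Pi.add_apply,
          hzero q hq, add_zero]
        obtain ⟨i, hi, rfl⟩ := (hκK q).1 hq
        rw [treeIndicator, if_pos ⟨i, hi, Nat.mod_lt _ (by positivity), rfl⟩]
    have hTP : T.toMatrix * patternProj K (Pi.single (κ 0) b) =
        patternProj K (fun _ => b) * (T.toMatrix * patternProj K (Pi.single (κ 0) b)) := by
      rw [h₁]
      ext x y
      rw [patternProj, patternProj, Matrix.diagonal_mul, Matrix.mul_diagonal]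
      by_cases hy : ∀ q ∈ K, y q = (Pi.single (κ 0) b : QBasis Q) q
      · by_cases hx : x = f y
        · have := hf y hy
          rw [← hx] at this
          simp only [if_pos this, one_mul]
        · simp [mapOp, hx]
      · simp [hy]
    -- The tree lives on `K` and `M` on the data, so uncopying passes through `M` and cancels the
    -- copying.
    have hMT : Commute (QCircuit.toMatrix T.reverse) M := by
      rw [hM]
      split_ifs
      · exact Commute.one_right _
      · refine QCircuit.commute_toMatrix fun l hl g hg => QGate.commute_subregister hδ ?_ _
        intro p hp
        obtain ⟨i, hi, h⟩ := treeCircuit_support (List.mem_reverse.1 hl) hg _ hp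
        exact hK p ((hκK _).2 ⟨i, hi, h⟩)
    rw [QCircuit.toMatrix_append, QCircuit.toMatrix_append, mul_assoc, mul_assoc, hTP,
      ← mul_assoc B.toMatrix, hB₃, mul_assoc M, ← hTP, ← mul_assoc _ M, hMT.eq, mul_assoc M,
      ← mul_assoc _ T.toMatrix, h₁, h₄, one_mul]

end

/-! ### Rewriting circuits over CNOT and single-qubit gates. -/

section Synthesis

variable {Q : Type} [Fintype Q] [DecidableEq Q]

theorem Synthesizable.exists_gates {k : ℕ} {M : Matrix (Fin 2 × Fin 2) (Fin 2 × Fin 2) ℂ}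
    (h : Synthesizable k M) {p q : Q} (hpq : p ≠ q) :
    ∃ l : List (QGate Q), l.length = k ∧ (∀ g ∈ l, g.IsCnotOrSingle) ∧
      (∀ g ∈ l, g.support ⊆ {p, q}) ∧ gatesOp l = (QLens.pair p q hpq).op M := by
  induction h with
  | first U =>
    refine ⟨[.one p U], rfl, by simp [QGate.IsCnotOrSingle], by simp [QGate.support], ?_⟩
    simp [QGate.toMatrix_one_eq_pair_first hpq]
  | second U =>
    refine ⟨[.one q U], rfl, by simp [QGate.IsCnotOrSingle], by simp [QGate.support], ?_⟩
    simp [QGate.toMatrix_one_eq_pair_second hpq]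
  | cnot =>
    refine ⟨[cnotGate p q], rfl, by simp [cnotGate_isCnotOrSingle], ?_, ?_⟩
    · simpa using support_cnotGate_subset p q
    · simp [QGate.toMatrix_cnotGate_eq_pair hpq]
  | cnot_swap =>
    refine ⟨[cnotGate q p], rfl, by simp [cnotGate_isCnotOrSingle], ?_, ?_⟩
    · rw [Finset.pair_comm]
      simpa using support_cnotGate_subset q p
    · simp [QGate.toMatrix_cnotGate_eq_pair_exchange hpq]
  | mul _ _ ih₁ ih₂ =>
    obtain ⟨l₁, a₁, b₁, c₁, d₁⟩ := ih₁
    obtain ⟨l₂, a₂, b₂, c₂, d₂⟩ := ih₂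
    refine ⟨l₁ ++ l₂, by rw [List.length_append, a₁, a₂], ?_, ?_, ?_⟩
    · intro g hg
      exact (List.mem_append.1 hg).elim (b₁ g) (b₂ g)
    · intro g hg
      exact (List.mem_append.1 hg).elim (c₁ g) (c₂ g)
    · rw [gatesOp_append, d₁, d₂, QLens.op_mul]

theorem gatesOp_replicate_one (q : Q) (k : ℕ) :
    gatesOp (List.replicate k (QGate.one q 1)) = 1 := by
  induction k with
  | zero => rfl
  | succ k ih =>
    rw [List.replicate_succ, gatesOp_cons, ih, QGate.toMatrix_one, mul_one]
    exact QLens.op_one _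

theorem QGate.exists_gates (g : QGate Q) :
    ∃ l : List (QGate Q), l.length = 35 ∧ (∀ k ∈ l, k.IsCnotOrSingle) ∧
      (∀ k ∈ l, k.support ⊆ g.support) ∧ gatesOp l = g.toMatrix := by
  cases g with
  | one q U =>
    -- Identity gates pad one-qubit gates to the common length 35, so that all gates of a layer can
    -- run in lockstep.
    refine ⟨.one q U :: List.replicate 34 (.one q 1), by simp, ?_, ?_, ?_⟩
    · intro k hk
      rcases List.mem_cons.1 hk with rfl | hk
      · trivial
      · rw [List.eq_of_mem_replicate hk]; trivial
    · intro k hk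
      rcases List.mem_cons.1 hk with rfl | hk
      · exact subset_rfl
      · rw [List.eq_of_mem_replicate hk]; exact subset_rfl
    · rw [gatesOp_cons, gatesOp_replicate_one, mul_one]
  | two p q h U =>
    rw [toMatrix_two]
    exact (synthesizable_of_unitary U).exists_gates h

/-- Lists of equal length on disjoint supports are executed in parallel, one gate of each list per
layer. -/
theorem exists_circuit_of_gates {gs : List (QGate Q)}
    (hgs : gs.Pairwise fun g h => Disjoint g.support h.support) (N : ℕ)
    (w : QGate Q → List (QGate Q)) (hN : ∀ g, (w g).length = N)
    (hw : ∀ g, ∀ k ∈ w g, k.IsCnotOrSingle) (hs : ∀ g, ∀ k ∈ w g, k.support ⊆ g.support) :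
    ∃ D : QCircuit Q, D.UsesCnotAndSingle ∧ D.depth = N ∧
      D.toMatrix = gatesOp (gs.flatMap w) := by
  induction N generalizing w with
  | zero =>
    refine ⟨[], by simp [QCircuit.UsesCnotAndSingle], rfl, ?_⟩
    have : w = fun _ => [] := funext fun g => List.length_eq_zero_iff.1 (hN g)
    have hnil : gs.flatMap w = [] := by
      rw [this, List.flatMap_eq_nil_iff]
      exact fun _ _ => rfl
    rw [hnil]; rfl
  | succ N ih =>
    have hex : ∀ g, ∃ k l, w g = k :: l := fun g => List.exists_cons_of_length_eq_add_one (hN g)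
    choose hd tl hcons using hex
    obtain ⟨D, hD₁, hD₂, hD₃⟩ := ih tl
      (fun g => by have := hN g; rw [hcons] at this; simpa using this)
      (fun g k hk => hw g k (by rw [hcons]; exact List.mem_cons_of_mem _ hk))
      (fun g k hk => hs g k (by rw [hcons]; exact List.mem_cons_of_mem _ hk))
    have hhd : ∀ g, ∀ k ∈ [hd g], k.support ⊆ g.support := by
      intro g k hk
      rw [List.mem_singleton] at hk
      exact hs g k (by rw [hcons, hk]; exact List.mem_cons_self)
    -- The head of a gate list is applied last, whereas the last layer of a circuit stands at the
    -- end; so the heads form the final layer.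
    refine ⟨D ++ [QLayer.ofGates (gs.flatMap fun g => [hd g])],
      QCircuit.usesCnotAndSingle_append hD₁ ?_, ?_, ?_⟩
    · intro l hl g hg
      rw [List.mem_singleton] at hl
      subst hl
      obtain ⟨g', _, hg'⟩ := List.mem_flatMap.1 (QLayer.mem_of_mem_ofGates hg)
      rw [List.mem_singleton] at hg'
      exact hw g' g (by rw [hcons, hg']; exact List.mem_cons_self)
    · rw [QCircuit.depth_append, hD₂]; rfl
    · rw [QCircuit.toMatrix_append, hD₃]
      simp only [QCircuit.toMatrix, one_mul, QLayer.toMatrix_eq]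
      rw [QLayer.gates_ofGates (pairwise_flatMap_disjoint hgs _ hhd (by simp)),
        gatesOp_flatMap_mul hgs _ _ hhd
          (fun g k hk => hs g k (by rw [hcons]; exact List.mem_cons_of_mem _ hk))]
      congr 2
      funext g
      exact (hcons g).symm

/-- Every circuit can be rewritten over CNOT and single-qubit gates with constant overhead. -/
theorem exists_cnotAndSingle_circuit (C : QCircuit Q) :
    ∃ D : QCircuit Q, D.UsesCnotAndSingle ∧ D.depth = 35 * C.depth ∧ D.toMatrix = C.toMatrix := by
  choose w hw₁ hw₂ hw₃ hw₄ using QGate.exists_gates (Q := Q)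
  induction C with
  | nil => exact ⟨[], by simp [QCircuit.UsesCnotAndSingle], rfl, rfl⟩
  | cons l C ih =>
    obtain ⟨D, hD₁, hD₂, hD₃⟩ := ih
    obtain ⟨E, hE₁, hE₂, hE₃⟩ := exists_circuit_of_gates l.disjoint 35 w hw₁ hw₂ hw₃
    refine ⟨E ++ D, QCircuit.usesCnotAndSingle_append hE₁ hD₁, ?_, ?_⟩
    · rw [QCircuit.depth_append, hE₂, hD₂, QCircuit.depth, QCircuit.depth, List.length_cons]
      ring
    · rw [QCircuit.toMatrix_append, hD₃, hE₃, QCircuit.toMatrix, QLayer.toMatrix_eq]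
      congr 1
      induction l.gates with
      | nil => rfl
      | cons g gs ih => rw [List.flatMap_cons, gatesOp_append, ih, hw₄, gatesOp_cons]

end Synthesis
end

/-! ### Ancillas, controlled operators and the Hadamard test. -/

noncomputable section

theorem Implements.comp {a n : ℕ} {D E : QCircuit (AncReg a n)} {M N : QOp (CtrlReg n)}
    (hD : Implements D M) (hE : Implements E N) : Implements (D ++ E : QCircuit _) (N * M) := by
  intro ψ
  rw [QCircuit.toMatrix_append, ← Matrix.mulVec_mulVec, hD, hE, Matrix.mulVec_mulVec]

/-- A single-qubit layer on the control qubit. -/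
def controlLayer (a n : ℕ) (V : Matrix.unitaryGroup (Fin 2) ℂ) : QCircuit (AncReg a n) :=
  [QLayer.ofGates [QGate.one (Sum.inl ()) V]]

theorem controlLayer_usesCnotAndSingle (a n : ℕ) (V : Matrix.unitaryGroup (Fin 2) ℂ) :
    (controlLayer a n V).UsesCnotAndSingle := by
  intro l hl g hg
  rw [controlLayer, List.mem_singleton] at hl
  subst hl
  have := QLayer.mem_of_mem_ofGates hg
  rw [List.mem_singleton] at this
  subst this
  trivial

theorem onControl_eq_op {n : ℕ} (V : Matrix (Fin 2) (Fin 2) ℂ) :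
    onControl (n := n) V = (QLens.qubit (Sum.inl () : CtrlReg n)).op V := by
  ext x y
  simp only [onControl, QLens.op, QLens.qubit]
  congr 1
  rw [eq_iff_iff, Function.update_eq_iff]
  constructor
  · intro h
    refine ⟨rfl, fun r hr => ?_⟩
    rcases r with r | r
    · exact absurd rfl hr
    · exact congrFun h r
  · rintro ⟨-, h⟩
    funext r
    exact h (Sum.inr r) (by simp)

theorem addZeroAncillas_update {a n : ℕ} (ψ : QState (CtrlReg n)) (x : QBasis (AncReg a n))
    (b : Fin 2) : addZeroAncillas a ψ (Function.update x (Sum.inl ()) b) =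
      if ∀ i : Fin a, x (Sum.inr (Sum.inl i)) = 0 then
        ψ (Function.update (x ∘ Sum.map id Sum.inr) (Sum.inl ()) b) else 0 := by
  have : Function.update x (Sum.inl ()) b ∘ Sum.map id Sum.inr =
      Function.update (x ∘ Sum.map id Sum.inr : QBasis (CtrlReg n)) (Sum.inl ()) b := by
    funext r
    rcases r with r | r
    · simp
    · simp
  simp only [addZeroAncillas, this]
  simp

theorem implements_controlLayer {a n : ℕ} (V : Matrix.unitaryGroup (Fin 2) ℂ) :
    Implements (controlLayer a n V) (onControl V.1) := by
  intro ψ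
  have : (controlLayer a n V).toMatrix = (QLens.qubit (Sum.inl () : AncReg a n)).op V.1 := by
    rw [← QGate.toMatrix_one]
    simp [controlLayer, QCircuit.toMatrix, QLayer.toMatrix_eq,
      QLayer.gates_ofGates (List.pairwise_singleton _ _)]
  rw [this, onControl_eq_op]
  funext x
  rw [QLens.op_mulVec]
  simp only [QLens.qubit, addZeroAncillas_update]
  simp only [addZeroAncillas]
  split_ifs with h
  · rw [QLens.op_mulVec]
    rfl
  · simp

/-- The inclusion of the data qubits. -/
def dataQubit (a n : ℕ) (i : Fin n) : AncReg a n := Sum.inr (Sum.inr i)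

theorem dataQubit_injective (a n : ℕ) : Function.Injective (dataQubit a n) :=
  Sum.inr_injective.comp Sum.inr_injective

/-- The control qubit followed by the ancillas. -/
def controlCopy (a n : ℕ) : ℕ → AncReg a n
  | 0 => Sum.inl ()
  | i + 1 => if h : i < a then Sum.inr (Sum.inl ⟨i, h⟩) else Sum.inl ()

/-- The control qubit and the ancillas. -/
def controlQubits (a n : ℕ) : Finset (AncReg a n) :=
  (Finset.range (a + 1)).image (controlCopy a n)

theorem controlCopy_injOn (a n : ℕ) :
    ∀ i < a + 1, ∀ j < a + 1, controlCopy a n i = controlCopy a n j → i = j := by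
  intro i hi j hj h
  cases i <;> cases j
  · rfl
  · rw [controlCopy, controlCopy, dif_pos (by omega)] at h
    simp at h
  · rw [controlCopy, controlCopy, dif_pos (by omega)] at h
    simp at h
  · rw [controlCopy, controlCopy, dif_pos (by omega), dif_pos (by omega)] at h
    simpa using h

theorem forall_controlQubits {a n : ℕ} {p : AncReg a n → Prop} :
    (∀ q ∈ controlQubits a n, p q) ↔ p (Sum.inl ()) ∧ ∀ i : Fin a, p (Sum.inr (Sum.inl i)) := by
  simp only [controlQubits, Finset.mem_image, Finset.mem_range, forall_exists_index, and_imp,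
    forall_apply_eq_imp_iff₂]
  constructor
  · intro h
    refine ⟨h 0 (by omega), fun i => ?_⟩
    have := h (i + 1) (by omega)
    rwa [controlCopy, dif_pos i.2] at this
  · rintro ⟨h₁, h₂⟩ i hi
    cases i with
    | zero => exact h₁
    | succ i =>
      rw [controlCopy, dif_pos (by omega)]
      exact h₂ _

theorem dataQubit_notMem (a n : ℕ) (i : Fin n) : dataQubit a n i ∉ controlQubits a n := by
  have : ∀ q ∈ controlQubits a n, q ≠ dataQubit a n i := by
    rw [forall_controlQubits]
    simp [dataQubit]
  exact fun h => this _ h rfl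

theorem controlled_mulVec {n : ℕ} (U : QOp (Fin n)) (ψ : QState (CtrlReg n))
    (z : QBasis (CtrlReg n)) : (controlled U).mulVec ψ z =
      if z (Sum.inl ()) = 0 then ψ z else
        ∑ u, U (z ∘ Sum.inr) u * ψ (Function.extend Sum.inr u z) := by
  have hinj : Function.Injective (Sum.inr : Fin n → CtrlReg n) := Sum.inr_injective
  have key : ∀ M : QOp (Fin n),
      ∑ y : QBasis (CtrlReg n), (if z (Sum.inl ()) = y (Sum.inl ()) then
        M (z ∘ Sum.inr) (y ∘ Sum.inr) else 0) * ψ y =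
      ((QLens.subregister _ hinj).op M).mulVec ψ z := by
    intro M
    simp only [Matrix.mulVec, dotProduct, QLens.op, QLens.subregister]
    refine Finset.sum_congr rfl fun y _ => ?_
    congr 1
    refine if_congr ?_ rfl rfl
    constructor
    · intro h
      funext r
      rcases r with r | r
      · rw [Function.extend_apply' _ _ _ (by simp)]; exact h
      · exact hinj.extend_apply _ _ r
    · intro h
      have := congrFun h (Sum.inl ())
      rwa [Function.extend_apply' _ _ _ (by simp)] at this
  by_cases hz : z (Sum.inl ()) = 0
  · rw [if_pos hz]
    have := key 1
    rw [QLens.op_one, Matrix.one_mulVec] at this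
    rw [← this]
    refine Finset.sum_congr rfl fun y _ => ?_
    congr 1
    simp only [controlled]
    by_cases h : z (Sum.inl ()) = y (Sum.inl ())
    · rw [if_pos h, if_pos h, if_pos (h ▸ hz)]
    · rw [if_neg h, if_neg h]
  · rw [if_neg hz]
    have := key U
    rw [QLens.op_mulVec] at this
    refine Eq.trans ?_ this
    refine Finset.sum_congr rfl fun y _ => ?_
    congr 1
    simp only [controlled]
    by_cases h : z (Sum.inl ()) = y (Sum.inl ())
    · rw [if_pos h, if_pos h, if_neg (h ▸ hz)]
    · rw [if_neg h, if_neg h]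

theorem patternProj_mulVec {Q : Type} [Fintype Q] [DecidableEq Q] (K : Finset Q) (v : QBasis Q)
    (φ : QState Q) (x : QBasis Q) :
    (patternProj K v).mulVec φ x = if ∀ q ∈ K, x q = v q then φ x else 0 := by
  rw [patternProj, Matrix.mulVec_diagonal]
  split_ifs <;> simp

/-- A circuit that acts correctly on both patterns of the control qubits implements the controlled
operator. -/
theorem implements_controlled {a n : ℕ} {D : QCircuit (AncReg a n)} {U : QOp (Fin n)}
    (hD : ∀ b : Fin 2, D.toMatrix * patternProj (controlQubits a n)
        (Pi.single (controlCopy a n 0) b) =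
      (if b = 0 then 1 else (QLens.subregister _ (dataQubit_injective a n)).op U) *
        patternProj (controlQubits a n) (Pi.single (controlCopy a n 0) b)) :
    Implements D (controlled U) := by
  intro ψ
  set φ := addZeroAncillas a ψ with hφ
  have hpat : ∀ (b : Fin 2) (x : QBasis (AncReg a n)), (∀ q ∈ controlQubits a n,
      x q = (Pi.single (controlCopy a n 0) b : QBasis (AncReg a n)) q) ↔
        x (Sum.inl ()) = b ∧ ∀ i : Fin a, x (Sum.inr (Sum.inl i)) = 0 := by
    intro b x
    rw [forall_controlQubits]
    simp [controlCopy]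
  -- With the ancillas at zero, only two patterns of the control qubits occur, one for each value of
  -- the control.
  have hsplit : φ = (patternProj (controlQubits a n) (Pi.single (controlCopy a n 0) 0)).mulVec φ +
      (patternProj (controlQubits a n) (Pi.single (controlCopy a n 0) 1)).mulVec φ := by
    funext x
    rw [Pi.add_apply, patternProj_mulVec, patternProj_mulVec]
    simp only [hpat]
    by_cases h : ∀ i : Fin a, x (Sum.inr (Sum.inl i)) = 0
    · have hb : x (Sum.inl ()) = 0 ∨ x (Sum.inl ()) = 1 := by
        generalize x (Sum.inl ()) = b
        fin_cases b <;> simp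
      rcases hb with hb | hb <;> simp [hb, h]
    · simp [hφ, addZeroAncillas, h]
  have h₀ := hD 0
  have h₁ := hD 1
  simp only [if_true, one_ne_zero, if_false, one_mul] at h₀ h₁
  rw [(subregister_commute_patternProj (dataQubit_injective a n) (dataQubit_notMem a n) U _).eq]
    at h₁
  rw [hsplit, Matrix.mulVec_add, Matrix.mulVec_mulVec, Matrix.mulVec_mulVec, h₀, h₁,
    ← Matrix.mulVec_mulVec]
  funext x
  rw [Pi.add_apply, patternProj_mulVec, patternProj_mulVec]
  simp only [hpat]
  by_cases h : ∀ i : Fin a, x (Sum.inr (Sum.inl i)) = 0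
  · have hx : addZeroAncillas a ((controlled U).mulVec ψ) x =
        (controlled U).mulVec ψ (x ∘ Sum.map id Sum.inr) := if_pos h
    rw [hx, controlled_mulVec]
    have hb : x (Sum.inl ()) = 0 ∨ x (Sum.inl ()) = 1 := by
      generalize x (Sum.inl ()) = b
      fin_cases b <;> simp
    rcases hb with hb | hb
    · simp [hb, h, hφ, addZeroAncillas]
    · simp only [hb, h, one_ne_zero, Function.comp_apply, Sum.map_inl, id_eq, if_false, false_and,
        true_and, zero_add, implies_true, if_true]
      rw [QLens.op_mulVec]
      refine Finset.sum_congr rfl fun u _ => ?_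
      have hinj : Function.Injective (Sum.inr : Fin n → CtrlReg n) := Sum.inr_injective
      have h0 : ∀ i : Fin a, Function.extend (dataQubit a n) u x (Sum.inr (Sum.inl i)) = 0 := by
        intro i
        rw [Function.extend_apply' _ _ _ (by simp [dataQubit])]
        exact h i
      have he : Function.extend (dataQubit a n) u x ∘ Sum.map id Sum.inr =
          (Function.extend Sum.inr u (x ∘ Sum.map id Sum.inr) : QBasis (CtrlReg n)) := by
        funext r
        rcases r with r | r
        · rw [Function.extend_apply' _ _ _ (by simp)]
          simp only [Function.comp_apply, Sum.map_inl, id_eq]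
          rw [Function.extend_apply' _ _ _ (by simp [dataQubit])]
        · rw [hinj.extend_apply]
          exact (dataQubit_injective a n).extend_apply u x r
      have hφu : φ (Function.extend (dataQubit a n) u x) =
          ψ (Function.extend (dataQubit a n) u x ∘ Sum.map id Sum.inr) := if_pos h0
      change U (x ∘ dataQubit a n) u * φ (Function.extend (dataQubit a n) u x) = _
      rw [hφu, he]
      rfl
  · simp [addZeroAncillas, h]

theorem le_two_pow_ceil_logb {x : ℝ} (hx : 0 < x) : x ≤ 2 ^ ⌈Real.logb 2 x⌉₊ := by
  rw [← Real.rpow_natCast, ← Real.logb_le_iff_le_rpow (by norm_num) hx]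
  exact Nat.le_ceil _

/-- The controlled version of a circuit over CNOT and single-qubit gates. -/
theorem exists_controlled {n s : ℕ} (hs : 1 ≤ s) (hsn : s ≤ n) (C : QCircuit (Fin n))
    (hC : C.UsesCnotAndSingle) :
    ∃ D : QCircuit (AncReg (s - 1) n), D.UsesCnotAndSingle ∧
      D.depth ≤ controlDepth n s C.depth ∧ Implements D (controlled C.toMatrix) := by
  have hsa : s - 1 + 1 = s := by omega
  have hs0 : (0 : ℝ) < s := by exact_mod_cast hs
  have hn0 : (0 : ℝ) < n := by exact_mod_cast (by omega : 0 < n)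
  obtain ⟨D, hD₁, hD₂, hD₃⟩ := exists_controlled_of_zeros (dataQubit_injective (s - 1) n)
    (dataQubit_notMem (s - 1) n) (κ := controlCopy (s - 1) n) (s := s)
    (L := ⌈Real.logb 2 ((n : ℝ) / s)⌉₊) (c := ⌈Real.logb 2 (s : ℝ)⌉₊) hs
    (by simp [controlQubits, hsa])
    (by have := controlCopy_injOn (s - 1) n; rwa [hsa] at this)
    (by
      rw [Fintype.card_fin]
      have := le_two_pow_ceil_logb (div_pos hn0 hs0)
      rw [div_le_iff₀ hs0, mul_comm] at this
      exact_mod_cast this)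
    (by
      have := le_two_pow_ceil_logb hs0
      exact_mod_cast this) C hC
  refine ⟨D, hD₁, ?_, implements_controlled hD₃⟩
  rw [hD₂, controlDepth]
  -- The construction needs only 8 of the 12 allowed multiples of the logarithm per layer.
  nlinarith [Nat.zero_le (C.depth * ⌈Real.logb 2 ((n : ℝ) / s)⌉₊)]

/-- The phase gate as a unitary. -/
def phaseGateUnitary : Matrix.unitaryGroup (Fin 2) ℂ :=
  ⟨phaseGate, by
    rw [Matrix.mem_unitaryGroup_iff]
    ext i j
    fin_cases i <;> fin_cases j <;> simp [Matrix.mul_apply, Matrix.star_apply, phaseGate]⟩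

theorem phaseGate_pow (j : ℕ) : phaseGate ^ j = !![1, 0; 0, Complex.I ^ j] := by
  have : phaseGate = Matrix.diagonal ![1, Complex.I] := by
    ext i j; fin_cases i <;> fin_cases j <;> simp [phaseGate]
  rw [this, Matrix.diagonal_pow]
  ext i j; fin_cases i <;> fin_cases j <;> simp

theorem zeroKet_eq_addZeroAncillas (a n : ℕ) :
    zeroKet (AncReg a n) = addZeroAncillas a (zeroKet (CtrlReg n)) := by
  funext x
  simp only [zeroKet, addZeroAncillas, Pi.single_apply]
  rw [← ite_and]
  refine if_congr ?_ rfl rfl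
  constructor
  · rintro rfl
    exact ⟨fun _ => rfl, rfl⟩
  · rintro ⟨h₁, h₂⟩
    funext r
    rcases r with r | r | r
    · exact congrFun h₂ (Sum.inl r)
    · exact h₁ r
    · exact congrFun h₂ (Sum.inr r)

/-- The amplitudes of the Hadamard test with outcome zero. -/
theorem hadamardTestOp_mulVec_zeroKet {n : ℕ} (U : QOp (Fin n)) (j : ℕ) (u : QBasis (Fin n)) :
    (hadamardTestOp U j).mulVec (zeroKet (CtrlReg n)) (Sum.elim (fun _ => 0) u) =
      ((if u = zeroBasis (Fin n) then 1 else 0) + Complex.I ^ j * U u (zeroBasis (Fin n))) / 2 := by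
  have hr := inv_sqrt_two_mul_self
  have h₁ : ∀ (b : Fin 2) (w : QBasis (Fin n)),
      (onControl hadamardGate).mulVec (zeroKet (CtrlReg n)) (Sum.elim (fun _ => b) w) =
        ((1 / Real.sqrt 2 : ℝ) : ℂ) * (if w = zeroBasis (Fin n) then 1 else 0) := by
    intro b w
    have hz : ∀ c : Fin 2, zeroKet (CtrlReg n) (Sum.elim (fun _ => c) w) =
        if c = 0 ∧ w = zeroBasis (Fin n) then 1 else 0 := by
      intro c
      rw [zeroKet, Pi.single_apply]
      refine if_congr ?_ rfl rfl
      constructor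
      · intro h
        exact ⟨congrFun h (Sum.inl ()), funext fun i => congrFun h (Sum.inr i)⟩
      · rintro ⟨rfl, rfl⟩
        funext r
        rcases r with r | r <;> rfl
    have hu : ∀ b c : Fin 2, Function.update (Sum.elim (fun _ => b) w : QBasis (CtrlReg n))
        (Sum.inl ()) c = Sum.elim (fun _ => c) w := by
      intro b c
      funext r
      rcases r with r | r <;> simp
    rw [onControl_eq_op, QLens.op_mulVec, Fin.sum_univ_two]
    simp only [QLens.qubit, hu, hz]
    fin_cases b <;> simp [hadamardGate]
  have h₂ : ∀ (b : Fin 2) (w : QBasis (Fin n)),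
      (controlled U).mulVec ((onControl hadamardGate).mulVec (zeroKet (CtrlReg n)))
        (Sum.elim (fun _ => b) w) = ((1 / Real.sqrt 2 : ℝ) : ℂ) *
          (if b = 0 then (if w = zeroBasis (Fin n) then 1 else 0) else
            U w (zeroBasis (Fin n))) := by
    intro b w
    have he : ∀ v : QBasis (Fin n), Function.extend Sum.inr v
        (Sum.elim (fun _ => b) w : QBasis (CtrlReg n)) = Sum.elim (fun _ => b) v := by
      intro v
      have hinj : Function.Injective (Sum.inr : Fin n → CtrlReg n) := Sum.inr_injective
      funext r
      rcases r with r | r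
      · rw [Function.extend_apply' _ _ _ (by simp)]; rfl
      · rw [hinj.extend_apply]; rfl
    rw [controlled_mulVec]
    simp only [he, h₁, Sum.elim_inl, Sum.elim_comp_inr]
    split_ifs <;> simp [mul_comm]
  have hu : ∀ c : Fin 2, Function.update (Sum.elim (fun _ => 0) u : QBasis (CtrlReg n))
      (Sum.inl ()) c = Sum.elim (fun _ => c) u := by
    intro c
    funext r
    rcases r with r | r <;> simp
  have hop : hadamardTestOp U j = onControl (hadamardGate * phaseGate ^ j) * controlled U *
      onControl hadamardGate := by
    rw [hadamardTestOp, onControl_eq_op, onControl_eq_op, onControl_eq_op, QLens.op_mul]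
  rw [hop, ← Matrix.mulVec_mulVec, ← Matrix.mulVec_mulVec, onControl_eq_op (_ * _),
    QLens.op_mulVec, Fin.sum_univ_two]
  simp only [QLens.qubit, hu, h₂]
  simp only [hadamardGate, phaseGate_pow]
  generalize ((1 / Real.sqrt 2 : ℝ) : ℂ) = r at hr
  generalize (if u = zeroBasis (Fin n) then (1 : ℂ) else 0) = t
  simp [Matrix.mul_apply]
  linear_combination (t + Complex.I ^ j * U u (zeroBasis (Fin n))) * hr

/-- The outcome probability is determined by the operator that a circuit implements. -/
theorem probZero_eq {a n : ℕ} {T : QCircuit (AncReg a n)} {M : QOp (CtrlReg n)}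
    (hT : Implements T M) : probZero T =
      ∑ u : QBasis (Fin n), ‖M.mulVec (zeroKet (CtrlReg n)) (Sum.elim (fun _ => 0) u)‖ ^ 2 := by
  rw [probZero, zeroKet_eq_addZeroAncillas, hT]
  symm
  -- Outcomes with a nonzero ancilla have amplitude zero, so only the data strings contribute.
  refine Fintype.sum_of_injective
    (fun u : QBasis (Fin n) => (Sum.elim (fun _ => 0) (Sum.elim (fun _ => 0) u) :
      QBasis (AncReg a n))) ?_ _ _ ?_ ?_
  · intro u u' h
    funext i
    exact congrFun h (Sum.inr (Sum.inr i))
  · intro x hx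
    by_cases h₀ : x (Sum.inl ()) = 0
    · have : ¬ ∀ i : Fin a, x (Sum.inr (Sum.inl i)) = 0 := by
        intro h
        refine hx ⟨fun i => x (Sum.inr (Sum.inr i)), ?_⟩
        funext r
        rcases r with r | r | r
        · exact h₀.symm
        · exact (h r).symm
        · rfl
      simp [addZeroAncillas, this]
    · simp [h₀]
  · intro u
    have : (Sum.elim (fun _ => 0) (Sum.elim (fun _ => 0) u) : QBasis (AncReg a n)) ∘
        Sum.map id Sum.inr = (Sum.elim (fun _ => 0) u : QBasis (CtrlReg n)) := by
      funext r
      rcases r with r | r <;> rfl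
    simp [addZeroAncillas, this]

theorem sum_norm_sq_column {ι : Type} [Fintype ι] [DecidableEq ι] {U : Matrix ι ι ℂ}
    (hU : U ∈ Matrix.unitaryGroup ι ℂ) (j : ι) : ∑ i, ‖U i j‖ ^ 2 = 1 := by
  have h : (star U * U) j j = 1 := by rw [Matrix.mem_unitaryGroup_iff'.1 hU, Matrix.one_apply_eq]
  have h' : ((∑ i, ‖U i j‖ ^ 2 : ℝ) : ℂ) = 1 := by
    rw [← h, Matrix.mul_apply, Complex.ofReal_sum]
    refine Finset.sum_congr rfl fun i _ => ?_
    rw [Matrix.star_apply, mul_comm, ← Complex.normSq_eq_norm_sq, ← Complex.mul_conj]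
    rfl
  exact_mod_cast h'

/-- Outcome zero with data `u` has amplitude half of `δ + iʲ * U u 0`, where `δ` is one at `u = 0`
and zero otherwise. Expanding the squares and using that column zero of `U` has norm one gives `(2 +
2 Re) / 4`. -/
theorem isHadamardTest_of_implements {a n : ℕ} {T : QCircuit (AncReg a n)} {U : QOp (Fin n)}
    (hU : U ∈ Matrix.unitaryGroup (QBasis (Fin n)) ℂ) {j : ℕ}
    (hT : Implements T (hadamardTestOp U j)) : IsHadamardTest T U j := by
  refine ⟨hT, ?_⟩
  rw [probZero_eq hT]
  have hterm : ∀ u : QBasis (Fin n),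
      ‖(hadamardTestOp U j).mulVec (zeroKet (CtrlReg n)) (Sum.elim (fun _ => 0) u)‖ ^ 2 =
        ((if u = zeroBasis (Fin n) then 1 else 0) + ‖U u (zeroBasis (Fin n))‖ ^ 2 +
          (if u = zeroBasis (Fin n) then
            2 * (Complex.I ^ j * U u (zeroBasis (Fin n))).re else 0)) / 4 := by
    intro u
    have hn : ‖U u (zeroBasis (Fin n))‖ = ‖Complex.I ^ j * U u (zeroBasis (Fin n))‖ := by simp
    rw [hadamardTestOp_mulVec_zeroKet, hn]
    generalize Complex.I ^ j * U u (zeroBasis (Fin n)) = w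
    rw [← Complex.normSq_eq_norm_sq, ← Complex.normSq_eq_norm_sq, Complex.normSq_div]
    split_ifs
    · rw [Complex.normSq_add]
      simp
      norm_num
    · simp
      norm_num
  rw [Finset.sum_congr rfl fun u _ => hterm u, ← Finset.sum_div, Finset.sum_add_distrib,
    Finset.sum_add_distrib, sum_norm_sq_column hU]
  simp
  ring

/-- A circuit for the Hadamard test from a circuit for the controlled operator. -/
theorem exists_hadamardTest {a n : ℕ} {D : QCircuit (AncReg a n)} (hD : D.UsesCnotAndSingle)
    {U : QOp (Fin n)} (hU : U ∈ Matrix.unitaryGroup (QBasis (Fin n)) ℂ)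
    (hDU : Implements D (controlled U)) (j : ℕ) :
    ∃ T : QCircuit (AncReg a n), T.UsesCnotAndSingle ∧ T.depth = D.depth + 2 ∧
      IsHadamardTest T U j := by
  -- `Sʲ` and the final Hadamard are merged into one single-qubit gate, so only two layers are added
  -- for every `j`.
  refine ⟨controlLayer a n hadamardUnitary ++ D ++
    controlLayer a n (hadamardUnitary * phaseGateUnitary ^ j),
    QCircuit.usesCnotAndSingle_append (QCircuit.usesCnotAndSingle_append
      (controlLayer_usesCnotAndSingle _ _ _) hD) (controlLayer_usesCnotAndSingle _ _ _), ?_, ?_⟩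
  · rw [QCircuit.depth_append, QCircuit.depth_append]
    simp [controlLayer, QCircuit.depth]
    omega
  · apply isHadamardTest_of_implements hU
    have h := ((implements_controlLayer (a := a) (n := n) hadamardUnitary).comp hDU).comp
      (implements_controlLayer (hadamardUnitary * phaseGateUnitary ^ j))
    have he : hadamardTestOp U j = onControl (hadamardUnitary * phaseGateUnitary ^ j).1 *
        (controlled U * onControl hadamardUnitary.1) := by
      rw [hadamardTestOp, ← mul_assoc]
      congr 2
      rw [onControl_eq_op, onControl_eq_op, onControl_eq_op, ← QLens.op_mul]
      rfl
    rw [he]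
    exact h

/-! ### Depth estimates. -/

theorem ceil_logb_le_two_mul {s : ℕ} (hs : 1 ≤ s) :
    (⌈Real.logb 2 (s : ℝ)⌉₊ : ℝ) ≤ 2 * Real.logb 2 (s : ℝ) := by
  rcases hs.eq_or_lt with rfl | hs
  · simp
  · have h₁ : 1 ≤ Real.logb 2 (s : ℝ) := by
      rw [Real.le_logb_iff_rpow_le (by norm_num) (by positivity), Real.rpow_one]
      exact_mod_cast hs
    have h₂ := Nat.ceil_lt_add_one (zero_le_one.trans h₁)
    linarith

theorem logb_ratio_nonneg {n s : ℕ} (hs : 1 ≤ s) (hsn : s ≤ n) :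
    0 ≤ Real.logb 2 ((n : ℝ) / (s : ℝ)) := by
  refine Real.logb_nonneg (by norm_num) ?_
  rw [one_le_div (by exact_mod_cast hs)]
  exact_mod_cast hsn

/-- Rounding up `log (n/s)` costs at most one per layer, so the coefficient of `d` becomes `12 + 9 =
21`, which dominates the other coefficients 4 and 12. -/
theorem controlDepth_le {n s : ℕ} (hs : 1 ≤ s) (hsn : s ≤ n) (d : ℕ) :
    (controlDepth n s d : ℝ) ≤ 21 * depthRate n s d := by
  have h₁ := ceil_logb_le_two_mul hs
  have h₂ := (Nat.ceil_lt_add_one (logb_ratio_nonneg hs hsn)).le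
  have h₃ : 0 ≤ Real.logb 2 (s : ℝ) := Real.logb_nonneg (by norm_num) (by exact_mod_cast hs)
  have h₄ := logb_ratio_nonneg hs hsn
  have h₅ : (0 : ℝ) ≤ d := Nat.cast_nonneg d
  have h₆ := mul_le_mul_of_nonneg_left h₂ h₅
  have h₇ := mul_nonneg h₅ h₄
  rw [controlDepth, depthRate]
  push_cast
  linarith

theorem le_depthRate {n s : ℕ} (hs : 1 ≤ s) (hsn : s ≤ n) (d : ℕ) :
    (d : ℝ) ≤ depthRate n s d := by
  have h₃ : 0 ≤ Real.logb 2 (s : ℝ) := Real.logb_nonneg (by norm_num) (by exact_mod_cast hs)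
  have h₇ := mul_nonneg (Nat.cast_nonneg (α := ℝ) d) (logb_ratio_nonneg hs hsn)
  rw [depthRate]
  linarith

theorem controlDepth_mul_le (n s d c : ℕ) (hc : 1 ≤ c) :
    controlDepth n s (c * d) ≤ c * controlDepth n s d := by
  rw [controlDepth, controlDepth]
  nlinarith [Nat.mul_le_mul_right (2 * ⌈Real.logb 2 (s : ℝ)⌉₊) hc]

end

/-- There is an absolute constant `K` such that for all `n`, all `s` with `1 ≤ s ≤ n` and all `d`
the following hold, with `s - 1` ancillas and hence `n + s` qubits throughout.
(1) `2⌈log s⌉ + 12 d ⌈log (n/s)⌉ + 9 d` is at most `K (log s + d log (n/s) + d)`.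
(2) For a depth-`d` circuit `C` of CNOT and single-qubit gates, Control-`C` has a circuit of CNOT
and single-qubit gates of depth at most `2⌈log s⌉ + 12 d ⌈log (n/s)⌉ + 9 d`, and the Hadamard tests
of `{|0ⁿ⟩, C}` have such circuits with two additional layers.
(3) For a depth-`d` circuit `C` of arbitrary one- and two-qubit gates, Control-`C` and (for `d ≥ 1`)
the Hadamard tests of `{|0ⁿ⟩, C}` have circuits of CNOT and single-qubit gates of depth at most
`K (log s + d log (n/s) + d)`. -/
theorem mainTheorem5 :
    ∃ K : ℝ, ∀ n s d : ℕ, 1 ≤ s → s ≤ n →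
      ((controlDepth n s d : ℝ) ≤ K * depthRate n s d) ∧
      (∀ C : QCircuit (Fin n), C.depth = d → C.UsesCnotAndSingle →
        (∃ D : QCircuit (AncReg (s - 1) n), D.UsesCnotAndSingle ∧
          D.depth ≤ controlDepth n s d ∧ Implements D (controlled C.toMatrix)) ∧
        (∀ j : ℕ, ∃ T : QCircuit (AncReg (s - 1) n), T.UsesCnotAndSingle ∧
          T.depth ≤ controlDepth n s d + 2 ∧ IsHadamardTest T C.toMatrix j)) ∧
      (∀ C : QCircuit (Fin n), C.depth = d →
        (∃ D : QCircuit (AncReg (s - 1) n), D.UsesCnotAndSingle ∧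
          (D.depth : ℝ) ≤ K * depthRate n s d ∧ Implements D (controlled C.toMatrix)) ∧
        (1 ≤ d → ∀ j : ℕ, ∃ T : QCircuit (AncReg (s - 1) n), T.UsesCnotAndSingle ∧
          (T.depth : ℝ) ≤ K * depthRate n s d ∧ IsHadamardTest T C.toMatrix j)) := by
  -- `737 = 35 * 21 + 2`: synthesis overhead times the rounding constant, plus the two layers of the
  -- Hadamard test, which `d ≥ 1` allows to be charged to the rate.
  refine ⟨737, fun n s d hs hsn => ?_⟩
  have hd := le_depthRate hs hsn d
  have hd0 : (0 : ℝ) ≤ d := Nat.cast_nonneg d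
  have hcd := controlDepth_le hs hsn d
  refine ⟨by linarith, ?_, ?_⟩
  · rintro C rfl hC
    obtain ⟨D, hD₁, hD₂, hD₃⟩ := exists_controlled hs hsn C hC
    refine ⟨⟨D, hD₁, hD₂, hD₃⟩, fun j => ?_⟩
    obtain ⟨T, hT₁, hT₂, hT₃⟩ := exists_hadamardTest hD₁ C.toMatrix_mem_unitary hD₃ j
    exact ⟨T, hT₁, by omega, hT₃⟩
  · rintro C rfl
    obtain ⟨C', hC₁, hC₂, hC₃⟩ := exists_cnotAndSingle_circuit C
    obtain ⟨D, hD₁, hD₂, hD₃⟩ := exists_controlled hs hsn C' hC₁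
    rw [hC₂] at hD₂
    rw [hC₃] at hD₃
    have hle : (D.depth : ℝ) ≤ 35 * controlDepth n s C.depth := by
      exact_mod_cast hD₂.trans (controlDepth_mul_le n s C.depth 35 (by norm_num))
    refine ⟨⟨D, hD₁, by linarith, hD₃⟩, fun hd1 j => ?_⟩
    have hd1' : (1 : ℝ) ≤ C.depth := by exact_mod_cast hd1
    obtain ⟨T, hT₁, hT₂, hT₃⟩ := exists_hadamardTest hD₁ C.toMatrix_mem_unitary hD₃ j
    refine ⟨T, hT₁, ?_, hT₃⟩
    rw [hT₂]
    push_cast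
    linarith
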